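/- **Definitions.** For a finite poset $\lambda$ and an integer $k\ge 1$ define $\mathsf q_k(\lambda)$ recursively by $\mathsf q_k(\varnothing)=0$, $\mathsf q_1(\lambda)=|\lambda|$, and, for $k>1$ and $\lambda\ne\varnothing$, $$\mathsf q_k(\lambda)=\min_{u\in\lambda}\max\{\mathsf q_k(\{v\in\lambda: v\not\succeq u\}),\ \mathsf q_{k-1}(\{v\in\lambda : v\succ u\})\}+1,$$ with the inherited orders on subsets. Let $T_2(x)=\binom x1+\binom x2=x(x+1)/2$, and let $\tau_2(x)$ be the least integer $t\ge 0$ with $x\le T_2(t)$. For a sequence $\boldsymbol u=(u_1,\dots,u_r)$ of elements of $\lambda$ put $\lambda_{\boldsymbol u}^{(i)}=\{v\in\lambda : v\succeq u_i,\ v\not\succeq u_j \text{ for } j<i\}$. Call $\boldsymbol u$ a $\lambda$-strategy if every element of $\lambda$ is $\succeq$ some $u_i$ and all $\lambda_{\boldsymbol u}^{(i)}$ are nonempty, and put $\mathsf Q_2(\lambda,\boldsymbol u)=\max_i(|\lambda_{\boldsymbol u}^{(i)}|+i-1)$. Products carry the product order, $[1,m]=\{1,\dots,m\}$, and $[\![m,n]\!]=[1,m]\times[1,n]$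 for $m,n\ge 1$. **Theorem.** (a) Let $\kappa,\nu$ be finite totally ordered sets with $|\kappa|\le 6$ or $|\nu|\le 6$. Then $\mathsf q_2(\kappa\times\nu)=9$ if $|\kappa|=|\nu|=6$, and $\mathsf q_2(\kappa\times\nu)=\tau_2(|\kappa||\nu|)$ otherwise. In particular, if $m\le 6$ or $n\le 6$, then $\mathsf q_2([\![m,n]\!])=9$ if $m=n=6$, and $\mathsf q_2([\![m,n]\!])=\tau_2(mn)$ otherwise. (b) Let $m,n\ge 1$ with $m\le 6$ or $n\le 6$. Then the following algorithm, started on $\lambda=[\![m,n]\!]$, terminates and returns a $\lambda$-strategy $\boldsymbol u$ with $\mathsf Q_2(\lambda,\boldsymbol u)=\mathsf q_2(\lambda)$. **Algorithm.** Start with the empty sequence $\boldsymbol u$ and repeat the following. Let the current poset be $[\![m,n]\!]$. If $m>n$, replace it by its transpose $[\![n,m]\!]$ and rename so that $m\le n$. Let $t=\tau_2(mn)$ and let $\boldsymbol v$ be the sequence listed below for $[\![m,n]\!]$. Let $\lambda'$ be the set of elements of $[\![m,n]\!]$ that are not $\succeq$ any entry of $\boldsymbol v$ (it is empty or again of the form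 $[\![m',n']\!]$). If the poset was transposed, transpose $\boldsymbol v$ and $\lambda'$ back, i.e. swap the coordinates. Append $\boldsymbol v$ to $\boldsymbol u$. If $\lambda'=\varnothing$, return $\boldsymbol u$; otherwise continue with $\lambda'$ as the current poset. **The sequences.** Here $a{:}w$ denotes the element $(a,\max(n-w,0)+1)$, i.e. the element of row $a$ with $w$ elements of its row weakly to its right (and the first element of the row if $w>n$). In each list the first condition that holds applies. $m=1$: $\ 1{:}t$. $m=2$: - $t$ even: $1{:}\frac t2$. - $n=2$ (so $t=3$): the elements $(2,1),(1,1)$. - $t$ odd: $2{:}t,\ 1{:}(t-1),\ 1{:}\frac{3(t-1)}2$. $m=3$: - $t=5$: $3{:}n$. - $t\equiv 0,1 \pmod 3$: $1{:}\lfloor t/3\rfloor$. - $t\equiv 2\pmod 6$: $2{:}\frac t2,\ 1{:}\frac{2t-1}3$. - $11\le t\equiv 5\pmod 6$: $3{:}t,\ 2{:}(t-1),\ 2{:}\frac{3(t-1)}2,\ 1{:}(t-3),\ 1{:}\frac{5t-10}3$. $m=4$: - $t\in\{6,7\}$: $4{:}n$. - $t=11$: $4{:}11,\ 3{:}10,\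 3{:}15,\ 2{:}8,\ 2{:}15,\ 1{:}6,\ 1{:}11,\ 1{:}15$. - $t\equiv 0,1\pmod 4$: $1{:}\lfloor t/4\rfloor$. - $10\le t\equiv 2\pmod 4$: $4{:}t,\ 3{:}(t-1),\ 2{:}(t-2),\ 1{:}(t-3),\ 1{:}\frac{5t-10}4$. - $t\equiv 3\pmod{12}$: $4{:}t,\ 3{:}(t-1),\ 2{:}(t-2),\ 2{:}\frac{4t-6}3,\ 1{:}(t-4),\ 3{:}\frac{11t-27}6,\ 1{:}\frac{5t-18}3,\ 1{:}(2t-7)$. - $19\le t\equiv 7\pmod{12}$: $4{:}t,\ 3{:}(t-1),\ 2{:}(t-2),\ 1{:}(t-3),\ 2{:}\frac{4t-7}3,\ 3{:}\frac{11t-29}6,\ 1{:}\frac{5t-17}3,\ 1{:}(2t-7)$. - $23\le t\equiv 11\pmod{12}$: $4{:}t,\ 3{:}(t-1),\ 3{:}\frac{3(t-1)}2,\ 2{:}(t-3),\ 2{:}\frac{5t-10}3,\ 1{:}(t-5),\ 1{:}\frac{7t-21}4$. $m=5$: - $t=9$: $5{:}n$. - $t=14$: $4{:}7,\ 3{:}9,\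 1{:}6,\ 2{:}11,\ 1{:}12$. - $t\equiv 0,1,2\pmod 5$: $1{:}\lfloor t/5\rfloor$. - $t\equiv 3\pmod{10}$: $4{:}\frac{t-1}2,\ 2{:}\frac{t-1}2,\ 1{:}\frac{3t-4}5$. - $t\equiv 8\pmod{10}$: $4{:}\frac t2,\ 2{:}\frac{t-2}2,\ 1{:}\frac{3t-4}5$. - $34\le t\equiv 4\pmod{30}$: $5{:}t,\ 4{:}(t-1),\ 3{:}(t-2),\ 2{:}(t-3),\ 1{:}(t-4),\ 4{:}\frac{3t-6}2,\ 3{:}\frac{5t-14}3,\ 1{:}\frac{3t-14}2,\ 1{:}\frac{9t-36}5$. - $39\le t\equiv 9\pmod{30}$: $5{:}t,\ 4{:}(t-1),\ 3{:}(t-2),\ 1{:}\frac{t-3}2,\ 4{:}\frac{3t-5}2,\ 3{:}\frac{5t-12}3,\ 2{:}\frac{3t-15}2,\ 1{:}\frac{3t-17}2,\ 1{:}\frac{9t-36}5$. - $44\le t\equiv 14\pmod{30}$: $5{:}t,\ 4{:}(t-1),\ 3{:}(t-2),\ 4{:}\frac{3t-4}2,\ 3{:}\frac{5t-10}3,\ 2{:}(t-5),\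 1{:}(t-6),\ 1{:}\frac{3t-18}2,\ 1{:}\frac{9t-36}5$. - $t\equiv 19\pmod{30}$: $5{:}t,\ 4{:}(t-1),\ 3{:}(t-2),\ 2{:}(t-3),\ 4{:}\frac{3t-5}2,\ 1{:}(t-5),\ 1{:}\frac{4t-16}3,\ 2{:}\frac{5t-17}3,\ 1{:}\frac{9t-36}5$. - $t\equiv 24\pmod{30}$: $5{:}t,\ 4{:}(t-1),\ 3{:}(t-2),\ 3{:}\frac{4t-6}3,\ 2{:}(t-4),\ 1{:}(t-5),\ 3{:}\frac{5t-12}3,\ 1{:}\frac{3t-16}2,\ 1{:}\frac{9t-36}5$. - $t\equiv 29\pmod{30}$: $5{:}t,\ 4{:}(t-1),\ 3{:}(t-2),\ 2{:}(t-3),\ 4{:}\frac{3t-5}2,\ 1{:}(t-5),\ 3{:}\frac{5t-13}3,\ 1{:}\frac{3t-15}2,\ 1{:}\frac{9t-36}5$. $m=6$: - $n=6$: the elements $(5,3),(4,2),(2,4),(3,1),(1,4),(2,1),(1,2),(1,1)$. - $7\le n\le 11$: $6{:}n$. - $n\in\{16,17,18,19,23,24\}$ or $t\equiv 0,1\pmod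 6$: $1{:}\lfloor t/6\rfloor$. - $16\le t\equiv 4\pmod 6$: $4{:}\frac{t-1}3,\ 1{:}\frac{t-1}3$. - $n=20$: the elements $(6,6),(5,7),(4,8),(3,9),(5,1),(1,16),(3,4),(1,12),(2,5),(3,1),(1,7),(2,1),(1,4),(1,2),(1,1)$. - $21\le t\equiv 3\pmod 6$: $4{:}\frac t3,\ 5{:}\frac{5t-3}6,\ 4{:}(t-1),\ 3{:}(t-3),\ 2{:}(t-4),\ 1{:}(t-5),\ 1{:}\frac{7t-21}6$. - $26\le t\equiv 2\pmod{12}$: $6{:}t,\ 5{:}(t-1),\ 4{:}(t-2),\ 3{:}(t-3),\ 3{:}\frac{5t-10}4,\ 2{:}(t-5),\ 1{:}(t-6),\ 1{:}\frac{4t-14}3$. - $17\le t\equiv 5\pmod{12}$ and $n\ge 25$: $6{:}t,\ 5{:}(t-1),\ 4{:}(t-2),\ 2{:}\frac{t-3}2,\ 1{:}\frac{2t-7}3,\ 1{:}(t-4),\ 3{:}\frac{5t-13}4,\ 1{:}\frac{4t-14}3$. - $20\le t\equiv 8\pmod{12}$: $6{:}t,\ 5{:}(t-1),\ 4{:}(t-2),\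 3{:}(t-3),\ 2{:}(t-4),\ 1{:}(t-5),\ 3{:}\frac{5t-12}4,\ 1{:}\frac{4t-14}3$. - $23\le t\equiv 11\pmod{12}$: $6{:}t,\ 5{:}(t-1),\ 4{:}(t-2),\ 3{:}(t-3),\ 2{:}(t-4),\ 3{:}\frac{5t-11}4,\ 1{:}(t-6),\ 1{:}\frac{4t-14}3$. -/

import Mathlib

universe u v

/-- `binomSum k x = ∑_{i=1}^k (x choose i)`; for `k = 2` this is the triangular number
`x (x + 1) / 2`. -/
def binomSum (k x : ℕ) : ℕ := ∑ i ∈ Finset.Icc 1 k, x.choose i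

/-- `tau k x` is the least `t` with `x ≤ binomSum k t` (for `k ≥ 1`). -/
noncomputable def tau (k x : ℕ) : ℕ := sInf {t : ℕ | x ≤ binomSum k t}

section Posets

variable {α : Type u} [PartialOrder α]

open Classical in
/-- The elements of `s` that are not above `a`. -/
noncomputable def notAbove (s : Finset α) (a : α) : Finset α := s.filter fun x => ¬ a ≤ x

open Classical in
/-- The elements of `s` that are strictly above `a`. -/
noncomputable def strictlyAbove (s : Finset α) (a : α) : Finset α := s.filter fun x => a < x

theorem card_notAbove_lt {s : Finset α} {a : α} (ha : a ∈ s) :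
    (notAbove s a).card < s.card := by
  classical
  unfold notAbove
  exact Finset.card_lt_card (Finset.filter_ssubset.2 ⟨a, ha, by simp⟩)

theorem card_strictlyAbove_lt {s : Finset α} {a : α} (ha : a ∈ s) :
    (strictlyAbove s a).card < s.card := by
  classical
  unfold strictlyAbove
  exact Finset.card_lt_card (Finset.filter_ssubset.2 ⟨a, ha, by simp⟩)

/-- The function `q_k` on finite posets, for `k ≥ 1`. A finite poset is given as a finite subset
`s` of a partial order, with the inherited order: the value is `0` on the empty poset, `|s|` for
`k = 1`, and otherwise the minimum over `a ∈ s` of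
`max (q_k {x ∈ s | ¬ a ≤ x}) (q_{k-1} {x ∈ s | a < x}) + 1`. -/
noncomputable def quicksand (k : ℕ) (s : Finset α) : ℕ :=
  if hs : s.Nonempty then
    if k ≤ 1 then s.card
    else
      s.attach.inf' ((Finset.attach_nonempty_iff).2 hs) (fun a =>
        max (quicksand k (notAbove s a.1)) (quicksand (k - 1) (strictlyAbove s a.1))) + 1
  else 0
termination_by s.card
decreasing_by
  · exact card_notAbove_lt a.2
  · exact card_strictlyAbove_lt a.2

open Classical in
/-- The elements of `s` that are not above any member of the sequence `w`. -/
noncomputable def remaining (s : Finset α) (w : List α) : Finset α :=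
  s.filter fun x => ∀ a ∈ w, ¬ a ≤ x

open Classical in
/-- The elements of `s` that are above the entry of `w` with index `i` (counted from `0`) and not
above any earlier entry. -/
noncomputable def region (s : Finset α) (w : List α) (i : Fin w.length) : Finset α :=
  s.filter fun x => w.get i ≤ x ∧ ∀ j : Fin w.length, j < i → ¬ w.get j ≤ x

/-- `w` is an `s`-strategy: a sequence of elements of `s` such that every element of `s` is above
some entry of `w`, and all the regions are nonempty. -/
def IsStrategy (s : Finset α) (w : List α) : Prop :=
  (∀ a ∈ w, a ∈ s) ∧ (∀ x ∈ s, ∃ a ∈ w, a ≤ x) ∧ ∀ i : Fin w.length, (region s w i).Nonempty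

/-- `Q_2(s, w)`: the maximum of `|i-th region| + i - 1` over the positions `i = 1, 2, …` of `w`
(here the index is counted from `0`, so that `i - 1` is the index itself). -/
noncomputable def stratCost (s : Finset α) (w : List α) : ℕ :=
  Finset.univ.sup fun i : Fin w.length => (region s w i).card + (i : ℕ)

end Posets

/-- The poset `[1,m] × [1,n]`, with the product order of `ℕ × ℕ`. The element `(a, b)` is the cell
in row `a` (rows are counted from the bottom) and column `b` (counted from the left). -/
def box (m n : ℕ) : Finset (ℕ × ℕ) := Finset.Icc 1 m ×ˢ Finset.Icc 1 n

/-! The sequences of cells used by the algorithm on `box m n` with `m ≤ n`. Here `t` stands for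
`tau 2 (m * n)`. A cell is given by its row and by the number of cells of that row that lie weakly
to the right of it, the latter written as the sum of the widths of the blocks to the right, from
left to right. -/

/-- The cell in row `a` with exactly `w` cells of its row weakly to the right of it, in a box with
`n` columns (the cell in the first column if `w > n`). -/
def cell (n a w : ℕ) : ℕ × ℕ := (a, n - w + 1)

/-- One row. -/
def diagram1 (n t : ℕ) : List (ℕ × ℕ) := [cell n 1 t]

/-- Two rows. -/
def diagram2 (n t : ℕ) : List (ℕ × ℕ) :=
  if t % 2 = 0 then [cell n 1 (t / 2)]
  else if n = 2 then [(2, 1), (1, 1)]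
  else [cell n 2 t, cell n 1 (t - 1), cell n 1 ((t - 1) / 2 + (t - 1))]

/-- Three rows. -/
def diagram3 (n t : ℕ) : List (ℕ × ℕ) :=
  if t = 5 then [cell n 3 n]
  else if t % 3 = 0 ∨ t % 3 = 1 then [cell n 1 (t / 3)]
  else if t % 6 = 2 then [cell n 2 (t / 2), cell n 1 ((2 * t - 1) / 3)]
  else if 11 ≤ t ∧ t % 6 = 5 then
    [cell n 3 t, cell n 2 (t - 1), cell n 2 ((t - 1) / 2 + (t - 1)), cell n 1 (t - 3),
      cell n 1 ((2 * t - 1) / 3 + (t - 3))]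
  else []

/-- Four rows. -/
def diagram4 (n t : ℕ) : List (ℕ × ℕ) :=
  if t = 6 ∨ t = 7 then [cell n 4 n]
  else if t = 11 then
    [cell n 4 11, cell n 3 10, cell n 3 (5 + 10), cell n 2 8, cell n 2 (7 + 8), cell n 1 6,
      cell n 1 (5 + 6), cell n 1 (4 + 5 + 6)]
  else if t % 4 = 0 ∨ t % 4 = 1 then [cell n 1 (t / 4)]
  else if 10 ≤ t ∧ t % 4 = 2 then
    [cell n 4 t, cell n 3 (t - 1), cell n 2 (t - 2), cell n 1 (t - 3),
      cell n 1 ((t + 2) / 4 + (t - 3))]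
  else if t % 12 = 3 then
    [cell n 4 t, cell n 3 (t - 1), cell n 2 (t - 2), cell n 2 (t / 3 + (t - 2)),
      cell n 1 (t - 4), cell n 3 ((t - 5) / 2 + (t - 3) / 3 + (t - 1)),
      cell n 1 ((2 * t - 6) / 3 + (t - 4)),
      cell n 1 ((t - 3) / 3 + (2 * t - 6) / 3 + (t - 4))]
  else if 19 ≤ t ∧ t % 12 = 7 then
    [cell n 4 t, cell n 3 (t - 1), cell n 2 (t - 2), cell n 1 (t - 3),
      cell n 2 ((t - 1) / 3 + (t - 2)), cell n 3 ((t - 5) / 2 + (t - 4) / 3 + (t - 1)),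
      cell n 1 ((2 * t - 8) / 3 + (t - 3)),
      cell n 1 ((t - 4) / 3 + (2 * t - 8) / 3 + (t - 3))]
  else if 23 ≤ t ∧ t % 12 = 11 then
    [cell n 4 t, cell n 3 (t - 1), cell n 3 ((t - 1) / 2 + (t - 1)), cell n 2 (t - 3),
      cell n 2 ((2 * t - 1) / 3 + (t - 3)), cell n 1 (t - 5),
      cell n 1 ((3 * t - 1) / 4 + (t - 5))]
  else []

/-- Five rows. -/
def diagram5 (n t : ℕ) : List (ℕ × ℕ) :=
  if t = 9 then [cell n 5 n]
  else if t = 14 then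
    [cell n 4 7, cell n 3 9, cell n 1 6, cell n 2 (5 + 6), cell n 1 (6 + 6)]
  else if t % 5 = 0 ∨ t % 5 = 1 ∨ t % 5 = 2 then [cell n 1 (t / 5)]
  else if t % 10 = 3 then
    [cell n 4 ((t - 1) / 2), cell n 2 ((t - 1) / 2), cell n 1 ((3 * t - 4) / 5)]
  else if t % 10 = 8 then
    [cell n 4 (t / 2), cell n 2 ((t - 2) / 2), cell n 1 ((3 * t - 4) / 5)]
  else if 34 ≤ t ∧ t % 30 = 4 then
    [cell n 5 t, cell n 4 (t - 1), cell n 3 (t - 2), cell n 2 (t - 3), cell n 1 (t - 4),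
      cell n 4 ((t - 4) / 2 + (t - 1)), cell n 3 ((2 * t - 8) / 3 + (t - 2)),
      cell n 1 ((t - 6) / 2 + (t - 4)),
      cell n 1 ((3 * t - 2) / 10 + (t - 6) / 2 + (t - 4))]
  else if 39 ≤ t ∧ t % 30 = 9 then
    [cell n 5 t, cell n 4 (t - 1), cell n 3 (t - 2), cell n 1 ((t - 3) / 2),
      cell n 4 ((t - 3) / 2 + (t - 1)), cell n 3 ((2 * t - 6) / 3 + (t - 2)),
      cell n 2 (t - 6 + (t - 3) / 2), cell n 1 (t - 7 + (t - 3) / 2),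
      cell n 1 ((3 * t + 13) / 10 + (t - 7) + (t - 3) / 2)]
  else if 44 ≤ t ∧ t % 30 = 14 then
    [cell n 5 t, cell n 4 (t - 1), cell n 3 (t - 2), cell n 4 ((t - 2) / 2 + (t - 1)),
      cell n 3 ((2 * t - 4) / 3 + (t - 2)), cell n 2 (t - 5), cell n 1 (t - 6),
      cell n 1 ((t - 6) / 2 + (t - 6)),
      cell n 1 ((3 * t + 18) / 10 + (t - 6) / 2 + (t - 6))]
  else if t % 30 = 19 then
    [cell n 5 t, cell n 4 (t - 1), cell n 3 (t - 2), cell n 2 (t - 3),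
      cell n 4 ((t - 3) / 2 + (t - 1)), cell n 1 (t - 5), cell n 1 ((t - 1) / 3 + (t - 5)),
      cell n 2 ((t - 1) / 3 + (t - 7) / 3 + (t - 3)),
      cell n 1 ((7 * t - 28) / 15 + (t - 1) / 3 + (t - 5))]
  else if t % 30 = 24 then
    [cell n 5 t, cell n 4 (t - 1), cell n 3 (t - 2), cell n 3 (t / 3 + (t - 2)),
      cell n 2 (t - 4), cell n 1 (t - 5), cell n 3 ((t - 6) / 3 + t / 3 + (t - 2)),
      cell n 1 ((t - 6) / 2 + (t - 5)),
      cell n 1 ((3 * t + 8) / 10 + (t - 6) / 2 + (t - 5))]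
  else if t % 30 = 29 then
    [cell n 5 t, cell n 4 (t - 1), cell n 3 (t - 2), cell n 2 (t - 3),
      cell n 4 ((t - 3) / 2 + (t - 1)), cell n 1 (t - 5),
      cell n 3 ((2 * t - 7) / 3 + (t - 2)), cell n 1 ((t - 5) / 2 + (t - 5)),
      cell n 1 ((3 * t + 3) / 10 + (t - 5) / 2 + (t - 5))]
  else []

/-- Six rows. -/
def diagram6 (n t : ℕ) : List (ℕ × ℕ) :=
  if n = 6 then [(5, 3), (4, 2), (2, 4), (3, 1), (1, 4), (2, 1), (1, 2), (1, 1)]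
  else if 7 ≤ n ∧ n ≤ 11 then [cell n 6 n]
  else if n ∈ [16, 17, 18, 19, 23, 24] ∨ t % 6 = 0 ∨ t % 6 = 1 then [cell n 1 (t / 6)]
  else if 16 ≤ t ∧ t % 6 = 4 then [cell n 4 ((t - 1) / 3), cell n 1 ((t - 1) / 3)]
  else if n = 20 then
    [(6, 6), (5, 7), (4, 8), (3, 9), (5, 1), (1, 16), (3, 4), (1, 12), (2, 5), (3, 1), (1, 7),
      (2, 1), (1, 4), (1, 2), (1, 1)]
  else if 21 ≤ t ∧ t % 6 = 3 then
    [cell n 4 (t / 3), cell n 5 ((t - 1) / 2 + t / 3), cell n 4 ((2 * t - 3) / 3 + t / 3),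
      cell n 3 (t - 3), cell n 2 (t - 4), cell n 1 (t - 5), cell n 1 ((t + 9) / 6 + (t - 5))]
  else if 26 ≤ t ∧ t % 12 = 2 then
    [cell n 6 t, cell n 5 (t - 1), cell n 4 (t - 2), cell n 3 (t - 3),
      cell n 3 ((t + 2) / 4 + (t - 3)), cell n 2 (t - 5), cell n 1 (t - 6),
      cell n 1 ((t + 4) / 3 + (t - 6))]
  else if 17 ≤ t ∧ t % 12 = 5 ∧ 25 ≤ n then
    [cell n 6 t, cell n 5 (t - 1), cell n 4 (t - 2), cell n 2 ((t - 3) / 2),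
      cell n 1 ((2 * t - 7) / 3), cell n 1 ((t - 5) / 3 + (2 * t - 7) / 3),
      cell n 3 ((t + 3) / 4 + (t - 5) / 3 + (t - 5) / 6 + (t - 3) / 2),
      cell n 1 ((t - 2) / 3 + (t - 5) / 3 + (2 * t - 7) / 3)]
  else if 20 ≤ t ∧ t % 12 = 8 then
    [cell n 6 t, cell n 5 (t - 1), cell n 4 (t - 2), cell n 3 (t - 3), cell n 2 (t - 4),
      cell n 1 (t - 5), cell n 3 (t / 4 + (t - 3)), cell n 1 ((t + 1) / 3 + (t - 5))]
  else if 23 ≤ t ∧ t % 12 = 11 then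
    [cell n 6 t, cell n 5 (t - 1), cell n 4 (t - 2), cell n 3 (t - 3), cell n 2 (t - 4),
      cell n 3 ((t + 1) / 4 + (t - 3)), cell n 1 (t - 6), cell n 1 ((t + 4) / 3 + (t - 6))]
  else []

/-- The sequence for `box m n` with `1 ≤ m ≤ 6` and `m ≤ n`, where `t = tau 2 (m * n)`. -/
def diagram (m n t : ℕ) : List (ℕ × ℕ) :=
  if m = 1 then diagram1 n t
  else if m = 2 then diagram2 n t
  else if m = 3 then diagram3 n t
  else if m = 4 then diagram4 n t
  else if m = 5 then diagram5 n t
  else if m = 6 then diagram6 n t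
  else []

/-- The sequence that one pass of the algorithm on `box m n` appends: the box is transposed first
if it has more rows than columns, and the sequence is then transposed back. -/
noncomputable def passSeq (m n : ℕ) : List (ℕ × ℕ) :=
  if n < m then (diagram n m (tau 2 (m * n))).map Prod.swap
  else diagram m n (tau 2 (m * n))

/-- `AlgReturns m n w`: the algorithm, started on `box m n`, terminates and returns the sequence
`w`. A pass appends `passSeq m n`; if no element remains, the algorithm ends, and otherwise it
goes on with the remaining elements, which have to form a box again. -/
inductive AlgReturns : ℕ → ℕ → List (ℕ × ℕ) → Prop
  | finish (m n : ℕ) (h : remaining (box m n) (passSeq m n) = ∅) : AlgReturns m n (passSeq m n)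
  | again (m n a b : ℕ) (w : List (ℕ × ℕ)) (h : remaining (box m n) (passSeq m n) ≠ ∅)
      (hab : remaining (box m n) (passSeq m n) = box a b) (hw : AlgReturns a b w) :
      AlgReturns m n (passSeq m n ++ w)

/-! That `q_2` is at most `t` means: some element has at most `t` elements weakly above it, and what
is left after removing these has `q_2` at most `t - 1`. Summing the region sizes, a poset of value
`t` has at most `t + (t - 1) + ... + 1 = T_2(t)` elements (`card_le_binomSum_quicksand`), which
gives the lower bound `tau_2(mn)`. For `m = n = 6` there is no slack, since 36 = `T_2(8)`: a
strategy of cost 8 would have regions of sizes exactly 8, 7, ..., 1, and a finite search shows that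
none exists (`not_hasPerfectStrategy_six`).

For the upper bound each pass of the algorithm is judged on its own. A pass of `r` entries is good
(`IsGoodPass`) if it respects the budgets `t, t - 1, ...` and the claimed value of the box it leaves
is at most `t - r`. Good passes can be chained, so induction on the number of elements gives
termination, a strategy and its cost at once (`exists_algReturns`). Except for 6 by 6 boxes, the
condition on the box left over only compares its area with `T_2(t - r)`.

Goodness is a finite computation for `n ≤ 25` (`isGoodPassShape_diagram`). For larger `n` and fixed
`m`, the value `t` runs through finitely many progressions `P * j + c`, on each of which all widths
are linear in `j`; finitely many inequalities between coefficients then settle all `j`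
simultaneously (`IsGoodFamily.isGoodPass`). -/

/-! ### Strategies as sequences played within a decreasing budget -/

section Budget

variable {α : Type u} [PartialOrder α]

open Classical in
/-- The elements of `s` that are weakly above `a`. -/
noncomputable def weaklyAbove (s : Finset α) (a : α) : Finset α := s.filter fun x => a ≤ x

theorem card_weaklyAbove {s : Finset α} {a : α} (ha : a ∈ s) :
    (weaklyAbove s a).card = (strictlyAbove s a).card + 1 := by
  classical
  have : weaklyAbove s a = insert a (strictlyAbove s a) := by
    ext x
    simp only [weaklyAbove, strictlyAbove, Finset.mem_filter, Finset.mem_insert]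
    constructor
    · rintro ⟨hx, hax⟩
      rcases hax.eq_or_lt with h | h
      · exact Or.inl h.symm
      · exact Or.inr ⟨hx, h⟩
    · rintro (rfl | ⟨hx, h⟩)
      · exact ⟨ha, le_rfl⟩
      · exact ⟨hx, h.le⟩
  rw [this, Finset.card_insert_of_notMem (by simp [strictlyAbove])]

theorem card_weaklyAbove_add_card_notAbove (s : Finset α) (a : α) :
    (weaklyAbove s a).card + (notAbove s a).card = s.card := by
  classical
  unfold weaklyAbove notAbove
  exact Finset.card_filter_add_card_filter_not _

/-- The sequence `w` can be played on `s` in such a way that the region of its first entry has at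
most `t` elements, that of its second entry at most `t - 1` elements, and so on. -/
def FitsBudget : Finset α → ℕ → List α → Prop
  | _, _, [] => True
  | s, t, a :: w => a ∈ s ∧ (weaklyAbove s a).card ≤ t ∧ FitsBudget (notAbove s a) (t - 1) w

theorem remaining_nil (s : Finset α) : remaining s [] = s := by
  simp [remaining]

theorem remaining_cons (s : Finset α) (a : α) (w : List α) :
    remaining s (a :: w) = remaining (notAbove s a) w := by
  ext x
  simp only [remaining, notAbove, Finset.mem_filter, List.forall_mem_cons]
  tauto

theorem remaining_append (s : Finset α) (w w' : List α) :
    remaining s (w ++ w') = remaining (remaining s w) w' := by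
  induction w generalizing s with
  | nil => simp [remaining_nil]
  | cons a w ih => simp [remaining_cons, ih]

theorem remaining_subset (s : Finset α) (w : List α) : remaining s w ⊆ s := by
  classical
  exact Finset.filter_subset _ _

theorem card_remaining_lt {s : Finset α} {a : α} (ha : a ∈ s) (w : List α) :
    (remaining s (a :: w)).card < s.card := by
  rw [remaining_cons]
  exact (Finset.card_le_card (remaining_subset _ _)).trans_lt (card_notAbove_lt ha)

theorem FitsBudget.mono {s : Finset α} {t t' : ℕ} {w : List α} (h : FitsBudget s t w)
    (ht : t ≤ t') : FitsBudget s t' w := by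
  induction w generalizing s t t' with
  | nil => trivial
  | cons a w ih => exact ⟨h.1, h.2.1.trans ht, ih h.2.2 (by omega)⟩

/-- Each entry uses up one unit of budget, whatever the size of its region. This is what allows the
passes of the algorithm to be treated one at a time. -/
theorem FitsBudget.append {s : Finset α} {t : ℕ} {w w' : List α} (h : FitsBudget s t w)
    (h' : FitsBudget (remaining s w) (t - w.length) w') : FitsBudget s t (w ++ w') := by
  induction w generalizing s t with
  | nil => simpa [remaining_nil] using h'
  | cons a w ih =>
    refine ⟨h.1, h.2.1, ih h.2.2 ?_⟩
    rw [remaining_cons] at h'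
    convert h' using 1
    simp only [List.length_cons]
    omega

theorem region_zero (s : Finset α) (a : α) (w : List α) :
    region s (a :: w) ⟨0, by simp⟩ = weaklyAbove s a := by
  ext x
  simp only [region, weaklyAbove, Finset.mem_filter]
  refine and_congr_right fun _ => ⟨fun h => h.1, fun h => ⟨h, fun j hj => ?_⟩⟩
  exact absurd hj (by simp)

theorem region_succ (s : Finset α) (a : α) (w : List α) (i : Fin w.length) :
    region s (a :: w) (Fin.succ i) = region (notAbove s a) w i := by
  ext x
  simp only [region, notAbove, Finset.mem_filter, and_assoc]
  refine and_congr_right fun _ => ?_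
  have : (∀ j : Fin (a :: w).length, j < i.succ → ¬ (a :: w).get j ≤ x) ↔
      ¬ a ≤ x ∧ ∀ j : Fin w.length, j < i → ¬ w.get j ≤ x := by
    constructor
    · intro h
      exact ⟨h ⟨0, by simp⟩ (by simp [Fin.lt_def]), fun j hj => h j.succ (by simpa using hj)⟩
    · rintro ⟨h0, h1⟩ j
      refine Fin.cases (fun _ => h0) (fun j hj => h1 j (by simpa using hj)) j
  have h2 : (a :: w).get i.succ = w.get i := rfl
  rw [this, h2]
  tauto

theorem remaining_eq_empty_iff (s : Finset α) (w : List α) :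
    remaining s w = ∅ ↔ ∀ x ∈ s, ∃ a ∈ w, a ≤ x := by
  classical
  simp [remaining, Finset.filter_eq_empty_iff]

theorem stratCost_le_iff (s : Finset α) (w : List α) (t : ℕ) :
    stratCost s w ≤ t ↔ ∀ i : Fin w.length, (region s w i).card + i ≤ t := by
  simp [stratCost]

theorem FitsBudget.spec {s : Finset α} {t : ℕ} {w : List α} (h : FitsBudget s t w) :
    (∀ a ∈ w, a ∈ s) ∧
      ∀ i : Fin w.length, (region s w i).Nonempty ∧ (region s w i).card + i ≤ t := by
  classical
  induction w generalizing s t with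
  | nil => exact ⟨by simp, fun i => i.elim0⟩
  | cons a w ih =>
    obtain ⟨ha, hc, hw⟩ := h
    obtain ⟨h1, h2⟩ := ih hw
    refine ⟨?_, ?_⟩
    · simp only [List.mem_cons, forall_eq_or_imp]
      exact ⟨ha, fun b hb => Finset.filter_subset _ _ (h1 b hb)⟩
    · intro i
      -- The first region contains `a`, so the truncated `t - 1` is a true predecessor.
      have hpos : 1 ≤ t := by
        have := card_weaklyAbove ha
        omega
      refine Fin.cases ?_ (fun i => ?_) i
      · have := region_zero s a w
        change (region s (a :: w) ⟨0, _⟩).Nonempty ∧ (region s (a :: w) ⟨0, _⟩).card + 0 ≤ t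
        rw [this]
        exact ⟨⟨a, by simp [weaklyAbove, ha]⟩, hc⟩
      · rw [region_succ]
        refine ⟨(h2 i).1, ?_⟩
        have := (h2 i).2
        simp only [Fin.val_succ]
        omega

theorem FitsBudget.isStrategy {s : Finset α} {t : ℕ} {w : List α} (h : FitsBudget s t w)
    (hr : remaining s w = ∅) : IsStrategy s w :=
  ⟨h.spec.1, (remaining_eq_empty_iff s w).1 hr, fun i => (h.spec.2 i).1⟩

theorem FitsBudget.stratCost_le {s : Finset α} {t : ℕ} {w : List α} (h : FitsBudget s t w) :
    stratCost s w ≤ t :=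
  (stratCost_le_iff s w t).2 fun i => (h.spec.2 i).2

theorem fitsBudget_of_region {s : Finset α} {t : ℕ} {w : List α}
    (hmem : ∀ a ∈ w, a ∈ s) (hne : ∀ i : Fin w.length, (region s w i).Nonempty)
    (hc : ∀ i : Fin w.length, (region s w i).card + i ≤ t) : FitsBudget s t w := by
  induction w generalizing s t with
  | nil => trivial
  | cons a w ih =>
    refine ⟨hmem a (by simp), ?_, ih ?_ ?_ ?_⟩
    · have := hc ⟨0, by simp⟩
      rwa [region_zero] at this
    · intro b hb
      obtain ⟨i, rfl⟩ := List.mem_iff_get.1 hb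
      -- A witness of the region of a later entry is above that entry but not above `a`, so the
      -- entry itself is not above `a`.
      obtain ⟨x, hx⟩ := hne i.succ
      rw [region_succ] at hx
      simp only [region, notAbove, Finset.mem_filter] at hx ⊢
      exact ⟨hmem _ (List.mem_cons_of_mem _ hb), fun h => hx.1.2 (h.trans hx.2.1)⟩
    · intro i
      rw [← region_succ]
      exact hne i.succ
    · intro i
      have := hc i.succ
      rw [region_succ, Fin.val_succ] at this
      omega

theorem IsStrategy.fitsBudget {s : Finset α} {w : List α} (h : IsStrategy s w) :
    FitsBudget s (stratCost s w) w :=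
  fitsBudget_of_region h.1 h.2.2 ((stratCost_le_iff s w _).1 le_rfl)

theorem notAbove_map {β : Type v} [PartialOrder β] (f : α ↪o β) (s : Finset α) (a : α) :
    notAbove (s.map f.toEmbedding) (f a) = (notAbove s a).map f.toEmbedding := by
  classical
  ext y
  simp only [notAbove, Finset.mem_filter, Finset.mem_map]
  constructor
  · rintro ⟨⟨x, hx, rfl⟩, h⟩
    exact ⟨x, ⟨hx, fun hax => h (f.le_iff_le.2 hax)⟩, rfl⟩
  · rintro ⟨x, ⟨hx, h⟩, rfl⟩
    exact ⟨⟨x, hx, rfl⟩, fun hax => h (f.le_iff_le.1 hax)⟩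

theorem card_weaklyAbove_map {β : Type v} [PartialOrder β] (f : α ↪o β) (s : Finset α) (a : α) :
    (weaklyAbove (s.map f.toEmbedding) (f a)).card = (weaklyAbove s a).card := by
  classical
  rw [← Finset.card_map f.toEmbedding]
  congr 1
  ext y
  simp only [weaklyAbove, Finset.mem_filter, Finset.mem_map]
  constructor
  · rintro ⟨⟨x, hx, rfl⟩, h⟩
    exact ⟨x, ⟨hx, f.le_iff_le.1 h⟩, rfl⟩
  · rintro ⟨x, ⟨hx, h⟩, rfl⟩
    exact ⟨⟨x, hx, rfl⟩, f.le_iff_le.2 h⟩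

theorem FitsBudget.map {β : Type v} [PartialOrder β] (f : α ↪o β) {s : Finset α} {t : ℕ}
    {w : List α} (h : FitsBudget s t w) :
    FitsBudget (s.map f.toEmbedding) t (w.map f) := by
  induction w generalizing s t with
  | nil => trivial
  | cons a w ih =>
    refine ⟨Finset.mem_map.2 ⟨a, h.1, rfl⟩, ?_, ?_⟩
    · rw [card_weaklyAbove_map]
      exact h.2.1
    · rw [notAbove_map]
      exact ih h.2.2

theorem remaining_map {β : Type v} [PartialOrder β] (f : α ↪o β) (s : Finset α) (w : List α) :
    remaining (s.map f.toEmbedding) (w.map f) = (remaining s w).map f.toEmbedding := by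
  induction w generalizing s with
  | nil => simp [remaining_nil]
  | cons a w ih => rw [List.map_cons, remaining_cons, notAbove_map, ih, remaining_cons]

end Budget

/-! ### The recursion for `q_2` and its invariance under order embeddings -/

section Quicksand

variable {α : Type u} [PartialOrder α]

theorem quicksand_empty (k : ℕ) : quicksand k (∅ : Finset α) = 0 := by
  rw [quicksand]
  simp

theorem quicksand_one (s : Finset α) : quicksand 1 s = s.card := by
  rw [quicksand]
  rcases s.eq_empty_or_nonempty with rfl | h
  · simp
  · simp [h]

/-- As `q_1` is the cardinality, the `+ 1` of the recursion can be absorbed by counting `a` itself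
among the elements above it. -/
theorem quicksand_two_le_iff {s : Finset α} (hs : s.Nonempty) (t : ℕ) :
    quicksand 2 s ≤ t ↔
      ∃ a ∈ s, quicksand 2 (notAbove s a) + 1 ≤ t ∧ (weaklyAbove s a).card ≤ t := by
  rw [quicksand]
  simp only [hs, dif_pos, Nat.reduceLeDiff, if_false]
  have key : ∀ u : ℕ, (s.attach.inf' ((Finset.attach_nonempty_iff).2 hs) (fun a =>
      max (quicksand 2 (notAbove s a.1)) (quicksand (2 - 1) (strictlyAbove s a.1)))) ≤ u ↔
      ∃ a ∈ s, quicksand 2 (notAbove s a) ≤ u ∧ (strictlyAbove s a).card ≤ u := by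
    intro u
    rw [Finset.inf'_le_iff]
    simp [quicksand_one, and_left_comm]
  constructor
  · intro h
    obtain ⟨a, ha, h1, h2⟩ := (key (t - 1)).1 (by omega)
    have := card_weaklyAbove ha
    exact ⟨a, ha, by omega, by omega⟩
  · rintro ⟨a, ha, h1, h2⟩
    have := card_weaklyAbove ha
    have := (key (t - 1)).2 ⟨a, ha, by omega, by omega⟩
    omega

theorem FitsBudget.quicksand_le {s : Finset α} {t : ℕ} {w : List α} (h : FitsBudget s t w)
    (hr : remaining s w = ∅) : quicksand 2 s ≤ t := by
  induction w generalizing s t with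
  | nil =>
    rw [remaining_nil] at hr
    simp [hr, quicksand_empty]
  | cons a w ih =>
    rw [remaining_cons] at hr
    have hc := card_weaklyAbove h.1
    have := h.2.1
    refine (quicksand_two_le_iff ⟨a, h.1⟩ t).2 ⟨a, h.1, ?_, h.2.1⟩
    have := ih h.2.2 hr
    omega

theorem IsStrategy.quicksand_le_stratCost {s : Finset α} {w : List α} (h : IsStrategy s w) :
    quicksand 2 s ≤ stratCost s w :=
  h.fitsBudget.quicksand_le ((remaining_eq_empty_iff s w).2 h.2.1)

/-- Comparing with every bound `t`, rather than asserting equality, lets the induction use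
`quicksand_two_le_iff` on both sides. -/
theorem quicksand_two_map_le_iff {β : Type v} [PartialOrder β] (f : α ↪o β) (s : Finset α)
    (t : ℕ) : quicksand 2 (s.map f.toEmbedding) ≤ t ↔ quicksand 2 s ≤ t := by
  classical
  induction hn : s.card using Nat.strong_induction_on generalizing s t with
  | _ n ih =>
    subst hn
    rcases s.eq_empty_or_nonempty with rfl | hs
    · simp [quicksand_empty]
    · rw [quicksand_two_le_iff hs, quicksand_two_le_iff (hs.map)]
      have hq : ∀ a ∈ s, (quicksand 2 ((notAbove s a).map f.toEmbedding) + 1 ≤ t ↔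
          quicksand 2 (notAbove s a) + 1 ≤ t) := by
        intro a ha
        have := ih _ (card_notAbove_lt ha) (notAbove s a) (t - 1) rfl
        omega
      constructor
      · rintro ⟨b, hb, h1, h2⟩
        obtain ⟨a, ha, rfl⟩ := Finset.mem_map.1 hb
        simp only [RelEmbedding.coe_toEmbedding] at h1 h2
        rw [notAbove_map, hq a ha] at h1
        rw [card_weaklyAbove_map] at h2
        exact ⟨a, ha, h1, h2⟩
      · rintro ⟨a, ha, h1, h2⟩
        refine ⟨f a, Finset.mem_map.2 ⟨a, ha, rfl⟩, ?_, ?_⟩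
        · rw [notAbove_map]
          exact (hq a ha).2 h1
        · rw [card_weaklyAbove_map]
          exact h2

theorem quicksand_two_map {β : Type v} [PartialOrder β] (f : α ↪o β) (s : Finset α) :
    quicksand 2 (s.map f.toEmbedding) = quicksand 2 s :=
  le_antisymm ((quicksand_two_map_le_iff f s _).2 le_rfl)
    ((quicksand_two_map_le_iff f s _).1 le_rfl)

end Quicksand

/-! ### Triangular numbers and the counting lower bound -/

section Triangular

theorem binomSum_two_zero : binomSum 2 0 = 0 := by decide

theorem binomSum_two_succ (t : ℕ) : binomSum 2 (t + 1) = binomSum 2 t + (t + 1) := by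
  simp only [binomSum, show Finset.Icc 1 2 = {1, 2} from rfl]
  simp [Nat.choose_succ_succ' t 1]
  omega

theorem two_mul_binomSum (t : ℕ) : 2 * binomSum 2 t = t * (t + 1) := by
  induction t with
  | zero => simp [binomSum_two_zero]
  | succ t ih =>
    rw [binomSum_two_succ, mul_add, ih]
    ring

theorem binomSum_two_mono : Monotone (binomSum 2) :=
  monotone_nat_of_le_succ fun t => by
    rw [binomSum_two_succ]
    omega

theorem le_binomSum_two (t : ℕ) : t ≤ binomSum 2 t := by
  cases t with
  | zero => simp
  | succ t =>
    rw [binomSum_two_succ]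
    omega

theorem tau_two_le_iff (x t : ℕ) : tau 2 x ≤ t ↔ x ≤ binomSum 2 t := by
  constructor
  · intro h
    have hne : {t : ℕ | x ≤ binomSum 2 t}.Nonempty := ⟨x, le_binomSum_two x⟩
    exact (Nat.sInf_mem hne : x ≤ binomSum 2 (tau 2 x)).trans (binomSum_two_mono h)
  · intro h
    exact Nat.sInf_le h

theorem lt_tau_two_iff (x t : ℕ) : t < tau 2 x ↔ binomSum 2 t < x := by
  rw [← not_le, tau_two_le_iff, not_le]

/-- An optimal first choice removes at most `t + 1` elements and leaves a set of value at most `t`,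
hence of at most `T_2(t)` elements by induction. -/
theorem card_le_binomSum_quicksand {α : Type u} [PartialOrder α] (s : Finset α) :
    s.card ≤ binomSum 2 (quicksand 2 s) := by
  induction hn : s.card using Nat.strong_induction_on generalizing s with
  | _ n ih =>
    subst hn
    rcases s.eq_empty_or_nonempty with rfl | hs
    · simp
    · obtain ⟨a, ha, h1, h2⟩ := (quicksand_two_le_iff hs _).1 le_rfl
      have h3 := ih _ (card_notAbove_lt ha) _ rfl
      have h4 := card_weaklyAbove_add_card_notAbove s a
      obtain ⟨t, ht⟩ : ∃ t, quicksand 2 s = t + 1 := ⟨quicksand 2 s - 1, by omega⟩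
      rw [ht] at h1 h2 ⊢
      have h5 : binomSum 2 (quicksand 2 (notAbove s a)) ≤ binomSum 2 t :=
        binomSum_two_mono (by omega)
      rw [binomSum_two_succ]
      omega

theorem tau_two_card_le_quicksand {α : Type u} [PartialOrder α] (s : Finset α) :
    tau 2 s.card ≤ quicksand 2 s :=
  (tau_two_le_iff _ _).2 (card_le_binomSum_quicksand s)

end Triangular

/-! ### Row lengths, and the exceptional 6 by 6 box -/

section Shapes

/-- The cells of the Young diagram with rows `1, …, m`, where row `x` has length `l x`. -/
def shape (m : ℕ) (l : ℕ → ℕ) : Finset (ℕ × ℕ) :=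
  (Finset.Icc 1 m).biUnion fun x => {x} ×ˢ Finset.Icc 1 (l x)

/-- The row lengths that remain when all cells above `a` are removed. -/
def cut (l : ℕ → ℕ) (a : ℕ × ℕ) (x : ℕ) : ℕ := if a.1 ≤ x then min (l x) (a.2 - 1) else l x

/-- The number of cells above `a` in `shape m l`. -/
def aboveSize (m : ℕ) (l : ℕ → ℕ) (a : ℕ × ℕ) : ℕ := ∑ x ∈ Finset.Icc a.1 m, (l x + 1 - a.2)

theorem mem_shape {m : ℕ} {l : ℕ → ℕ} {p : ℕ × ℕ} :
    p ∈ shape m l ↔ (1 ≤ p.1 ∧ p.1 ≤ m) ∧ 1 ≤ p.2 ∧ p.2 ≤ l p.1 := by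
  obtain ⟨x, y⟩ := p
  simp [shape]

theorem mem_box {m n : ℕ} {p : ℕ × ℕ} :
    p ∈ box m n ↔ (1 ≤ p.1 ∧ p.1 ≤ m) ∧ 1 ≤ p.2 ∧ p.2 ≤ n := by
  simp [box]

theorem card_box (m n : ℕ) : (box m n).card = m * n := by
  simp [box]

theorem box_eq_shape (m n : ℕ) : box m n = shape m fun _ => n := by
  ext p
  simp only [mem_shape, mem_box]

theorem shape_eq_box {m a b : ℕ} {l : ℕ → ℕ} (ha : a ≤ m)
    (h : ∀ x, 1 ≤ x → x ≤ m → l x = if x ≤ a then b else 0) : shape m l = box a b := by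
  ext p
  simp only [mem_shape, mem_box]
  constructor
  · rintro ⟨h1, h2⟩
    rw [h _ h1.1 h1.2] at h2
    split_ifs at h2 <;> omega
  · rintro ⟨h1, h2⟩
    rw [h _ h1.1 (by omega), if_pos h1.2]
    omega

/-- Play on a box thus reduces to arithmetic with row lengths. Monotonicity of `l` is not needed. -/
theorem notAbove_shape (m : ℕ) (l : ℕ → ℕ) (a : ℕ × ℕ) :
    notAbove (shape m l) a = shape m (cut l a) := by
  ext p
  simp only [notAbove, Finset.mem_filter, mem_shape, cut, Prod.le_def]
  split_ifs <;> omega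

theorem card_weaklyAbove_shape {m : ℕ} {l : ℕ → ℕ} {a : ℕ × ℕ} (ha : a ∈ shape m l) :
    (weaklyAbove (shape m l) a).card = aboveSize m l a := by
  classical
  rw [mem_shape] at ha
  have : weaklyAbove (shape m l) a =
      (Finset.Icc a.1 m).biUnion fun x => {x} ×ˢ Finset.Icc a.2 (l x) := by
    ext ⟨x, y⟩
    simp only [weaklyAbove, Finset.mem_filter, mem_shape, Prod.le_def, Finset.mem_biUnion,
      Finset.mem_product, Finset.mem_singleton, Finset.mem_Icc]
    constructor
    · rintro h
      exact ⟨x, by omega, rfl, by omega⟩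
    · rintro ⟨x', h1, rfl, h2⟩
      omega
  rw [this, Finset.card_biUnion, aboveSize]
  · simp
  · intro x _ y _ hxy
    rw [Function.onFun, Finset.disjoint_left]
    simp only [Finset.mem_product, Finset.mem_singleton]
    rintro p ⟨rfl, _⟩ ⟨h, _⟩
    exact hxy h

theorem remaining_shape (m : ℕ) (l : ℕ → ℕ) (w : List (ℕ × ℕ)) :
    remaining (shape m l) w = shape m (w.foldl cut l) := by
  induction w generalizing l with
  | nil => simp [remaining_nil]
  | cons a w ih => rw [remaining_cons, notAbove_shape, ih, List.foldl_cons]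

/-- `FitsBudget` for the shape with rows `l`, in terms of row lengths. -/
def ShapeFits (m : ℕ) : (ℕ → ℕ) → ℕ → List (ℕ × ℕ) → Prop
  | _, _, [] => True
  | l, t, a :: w =>
    ((1 ≤ a.1 ∧ a.1 ≤ m) ∧ 1 ≤ a.2 ∧ a.2 ≤ l a.1) ∧ aboveSize m l a ≤ t ∧
      ShapeFits m (cut l a) (t - 1) w

instance ShapeFits.decidable (m : ℕ) :
    ∀ (l : ℕ → ℕ) (t : ℕ) (w : List (ℕ × ℕ)), Decidable (ShapeFits m l t w)
  | _, _, [] => .isTrue trivial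
  | l, t, a :: w =>
    have := ShapeFits.decidable m (cut l a) (t - 1) w
    inferInstanceAs (Decidable (_ ∧ _ ∧ _))

theorem ShapeFits.fitsBudget {m : ℕ} {l : ℕ → ℕ} {t : ℕ} {w : List (ℕ × ℕ)}
    (h : ShapeFits m l t w) : FitsBudget (shape m l) t w := by
  induction w generalizing l t with
  | nil => trivial
  | cons a w ih =>
    obtain ⟨h1, h2, h3⟩ := h
    have ha : a ∈ shape m l := mem_shape.2 h1
    refine ⟨ha, ?_, ?_⟩
    · rwa [card_weaklyAbove_shape ha]
    · rw [notAbove_shape]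
      exact ih h3

/-- `shape m l` has a strategy whose regions have sizes exactly `t, t - 1, …, 1`, in this
order. -/
def HasPerfectStrategy (m : ℕ) : (ℕ → ℕ) → ℕ → Prop
  | _, 0 => True
  | l, t + 1 => ∃ x ∈ Finset.Icc 1 m, ∃ y ∈ Finset.Icc 1 (l x),
      aboveSize m l (x, y) = t + 1 ∧ HasPerfectStrategy m (cut l (x, y)) t

instance HasPerfectStrategy.decidable (m : ℕ) :
    ∀ (l : ℕ → ℕ) (t : ℕ), Decidable (HasPerfectStrategy m l t)
  | _, 0 => .isTrue trivial
  | l, t + 1 =>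
    have := fun x y => HasPerfectStrategy.decidable m (cut l (x, y)) t
    inferInstanceAs (Decidable (∃ x ∈ Finset.Icc 1 m, ∃ y ∈ Finset.Icc 1 (l x), _ ∧ _))

/-- The region has at most `t + 1` elements and the rest at most `T_2(t)`; since the total is `T_2(t
+ 1)`, both bounds are attained, and the rest satisfies the same hypotheses. -/
theorem hasPerfectStrategy_of_quicksand_le {m : ℕ} {l : ℕ → ℕ} {t : ℕ}
    (hq : quicksand 2 (shape m l) ≤ t) (hc : (shape m l).card = binomSum 2 t) :
    HasPerfectStrategy m l t := by
  induction t generalizing l with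
  | zero => trivial
  | succ t ih =>
    rw [binomSum_two_succ] at hc
    have hne : (shape m l).Nonempty := Finset.card_pos.1 (by omega)
    obtain ⟨⟨x, y⟩, ha, h1, h2⟩ := (quicksand_two_le_iff hne _).1 hq
    have h3 := card_weaklyAbove_add_card_notAbove (shape m l) (x, y)
    rw [card_weaklyAbove_shape ha] at h2 h3
    rw [notAbove_shape] at h1 h3
    have h4 := card_le_binomSum_quicksand (shape m (cut l (x, y)))
    have h5 : binomSum 2 (quicksand 2 (shape m (cut l (x, y)))) ≤ binomSum 2 t :=
      binomSum_two_mono (by omega)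
    have ha' := mem_shape.1 ha
    exact ⟨x, Finset.mem_Icc.2 ha'.1, y, Finset.mem_Icc.2 ha'.2, by omega,
      ih (by omega) (by omega)⟩

-- Requiring exact sizes prunes the search tree enough for an exhaustive check.
set_option maxRecDepth 10000 in
theorem not_hasPerfectStrategy_six : ¬ HasPerfectStrategy 6 (fun _ => 6) 8 := by
  decide +kernel

theorem eight_lt_quicksand_box_six : 8 < quicksand 2 (box 6 6) := by
  by_contra h
  rw [not_lt, box_eq_shape] at h
  refine not_hasPerfectStrategy_six (hasPerfectStrategy_of_quicksand_le h ?_)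
  rw [← box_eq_shape, card_box]
  decide

end Shapes

/-! ### Good passes and transposition -/

section Passes

/-- The value of `quicksand 2 (box m n)` when `m ≤ 6` or `n ≤ 6`. -/
noncomputable def boxValue (m n : ℕ) : ℕ := if m = 6 ∧ n = 6 then 9 else tau 2 (m * n)

theorem boxValue_comm (m n : ℕ) : boxValue m n = boxValue n m := by
  simp only [boxValue, mul_comm, and_comm]

theorem tau_le_boxValue (m n : ℕ) : tau 2 (m * n) ≤ boxValue m n := by
  unfold boxValue
  split_ifs with h
  · rw [h.1, h.2, tau_two_le_iff]
    decide
  · exact le_rfl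

theorem boxValue_le {m n t : ℕ} (h : m * n ≤ binomSum 2 t) (h6 : m = 6 → n = 6 → 9 ≤ t) :
    boxValue m n ≤ t := by
  unfold boxValue
  split_ifs with hmn
  · exact h6 hmn.1 hmn.2
  · exact (tau_two_le_iff _ _).2 h

/-- Playing `w` on `box m n` stays within the budget, and what remains is a box whose value is at
most the remaining budget. -/
structure IsGoodPass (m n : ℕ) (w : List (ℕ × ℕ)) : Prop where
  ne_nil : w ≠ []
  fitsBudget : FitsBudget (box m n) (boxValue m n) w
  remaining_eq : ∃ a b, remaining (box m n) w = box a b ∧ boxValue a b ≤ boxValue m n - w.length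

theorem map_swap_box (m n : ℕ) :
    (box m n).map (OrderIso.prodComm (α := ℕ) (β := ℕ)).toOrderEmbedding.toEmbedding =
      box n m := by
  ext ⟨x, y⟩
  simp only [Finset.mem_map, mem_box, Prod.exists]
  constructor
  · rintro ⟨a, b, h, hab⟩
    obtain ⟨rfl, rfl⟩ : b = x ∧ a = y := by simpa using hab
    exact ⟨h.2, h.1⟩
  · intro h
    exact ⟨y, x, ⟨h.2, h.1⟩, rfl⟩

theorem IsGoodPass.swap {m n : ℕ} {w : List (ℕ × ℕ)} (h : IsGoodPass m n w) :
    IsGoodPass n m (w.map Prod.swap) := by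
  have hw : w.map Prod.swap = w.map (OrderIso.prodComm (α := ℕ) (β := ℕ)).toOrderEmbedding := rfl
  refine ⟨by simpa using h.ne_nil, ?_, ?_⟩
  · rw [hw, ← map_swap_box, boxValue_comm]
    exact h.fitsBudget.map _
  · obtain ⟨a, b, hr, hv⟩ := h.remaining_eq
    refine ⟨b, a, ?_, ?_⟩
    · rw [hw, ← map_swap_box m n, remaining_map, hr, map_swap_box]
    · rwa [List.length_map, boxValue_comm b a, boxValue_comm n m]

end Passes

/-! ### Families linear in a parameter, and their numerical criterion -/

section Families

/-! Families of sequences for `box m n` with `tau 2 (m * n) = P * j + c`, where `m`, `P`, `c` are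
fixed and `j` varies. An entry `(a, p, q)` stands for the cell in row `a` with `p * j + q` cells
of its row weakly to its right. The widths of the cut off parts of the rows are kept as pairs
`(p, q)` too, and all comparisons are made coefficientwise. -/

/-- The number `p * j + q` for `e = (p, q)`. -/
def linVal (j : ℕ) (e : ℕ × ℕ) : ℕ := e.1 * j + e.2

/-- The cell that an entry stands for. -/
def symCell (n j : ℕ) (e : ℕ × ℕ × ℕ) : ℕ × ℕ := cell n e.1 (linVal j e.2)

/-- The widths that are cut off after the entry `e`. -/
def symCut (W : ℕ → ℕ × ℕ) (e : ℕ × ℕ × ℕ) (x : ℕ) : ℕ × ℕ :=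
  if e.1 ≤ x then (max (W x).1 e.2.1, max (W x).2 e.2.2) else W x

/-- The sequence is playable within the budget `P * j + c` for every `j`, if the widths `W` are cut
off already. -/
def SymFits (m P : ℕ) : (ℕ → ℕ × ℕ) → ℕ → List (ℕ × ℕ × ℕ) → Prop
  | _, _, [] => True
  | W, c, e :: L =>
    ((1 ≤ e.1 ∧ e.1 ≤ m) ∧ 1 ≤ c ∧ (W e.1).1 ≤ e.2.1 ∧ (W e.1).2 < e.2.2) ∧
      (∀ x ∈ Finset.Icc e.1 m, W x ≤ e.2 ∨ e.2 ≤ W x) ∧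
      ∑ x ∈ Finset.Icc e.1 m, (e.2.1 - (W x).1) ≤ P ∧
      ∑ x ∈ Finset.Icc e.1 m, (e.2.2 - (W x).2) ≤ c ∧
      SymFits m P (symCut W e) (c - 1) L

instance SymFits.decidable (m P : ℕ) :
    ∀ (W : ℕ → ℕ × ℕ) (c : ℕ) (L : List (ℕ × ℕ × ℕ)), Decidable (SymFits m P W c L)
  | _, _, [] => .isTrue trivial
  | W, c, e :: L =>
    have := SymFits.decidable m P (symCut W e) (c - 1) L
    inferInstanceAs (Decidable (_ ∧ _ ∧ _ ∧ _ ∧ _))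

theorem linVal_mono (j : ℕ) {e f : ℕ × ℕ} (h : e ≤ f) : linVal j e ≤ linVal j f :=
  Nat.add_le_add (Nat.mul_le_mul_right j h.1) h.2

/-- Comparability in both coefficients is what makes truncated subtraction, and likewise the maximum
below, commute with evaluation at `j`. -/
theorem linVal_sub (j : ℕ) {e f : ℕ × ℕ} (h : e ≤ f ∨ f ≤ e) :
    linVal j f - linVal j e = (f.1 - e.1) * j + (f.2 - e.2) := by
  rcases h with h | h
  · obtain ⟨p, hp⟩ := Nat.exists_eq_add_of_le h.1
    obtain ⟨q, hq⟩ := Nat.exists_eq_add_of_le h.2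
    simp only [linVal, hp, hq, Nat.add_sub_cancel_left]
    have : (e.1 + p) * j = e.1 * j + p * j := by ring
    omega
  · have h1 := linVal_mono j h
    have h2 : f.1 - e.1 = 0 := Nat.sub_eq_zero_of_le h.1
    have h3 : f.2 - e.2 = 0 := Nat.sub_eq_zero_of_le h.2
    rw [h2, h3]
    omega

theorem linVal_max (j : ℕ) {e f : ℕ × ℕ} (h : e ≤ f ∨ f ≤ e) :
    linVal j (max e.1 f.1, max e.2 f.2) = max (linVal j e) (linVal j f) := by
  rcases h with h | h
  · rw [max_eq_right h.1, max_eq_right h.2, max_eq_right (linVal_mono j h)]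
  · rw [max_eq_left h.1, max_eq_left h.2, max_eq_left (linVal_mono j h)]

/-- Region sizes are linear in `j` with coefficients bounded by `P` and `c`. The hypothesis `hn`
keeps every cell from being clamped to the first column, and the strict inequality between constant
terms in `SymFits` keeps each entry inside the shape, even for `j = 0`. -/
theorem SymFits.shapeFits {m P c n j : ℕ} {W : ℕ → ℕ × ℕ} {l : ℕ → ℕ} {L : List (ℕ × ℕ × ℕ)}
    (h : SymFits m P W c L) (hn : ∀ e ∈ L, linVal j e.2 ≤ n)
    (hl : ∀ x, 1 ≤ x → x ≤ m → l x = n - linVal j (W x)) :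
    ShapeFits m l (P * j + c) (L.map (symCell n j)) ∧
      ∀ x, 1 ≤ x → x ≤ m →
        (L.map (symCell n j)).foldl cut l x = n - linVal j (L.foldl symCut W x) := by
  induction L generalizing W l c with
  | nil => exact ⟨trivial, hl⟩
  | cons e L ih =>
    obtain ⟨⟨ha, hc, hp, hq⟩, hcomp, hP, hC, hL⟩ := h
    have hen : linVal j e.2 ≤ n := hn e (by simp)
    have hlt : linVal j (W e.1) < linVal j e.2 :=
      Nat.add_lt_add_of_le_of_lt (Nat.mul_le_mul_right j hp) hq
    have hcut : ∀ x, 1 ≤ x → x ≤ m →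
        cut l (symCell n j e) x = n - linVal j (symCut W e x) := by
      intro x hx1 hx2
      simp only [cut, symCell, cell, symCut, hl x hx1 hx2]
      split_ifs with hx
      · rw [linVal_max j (hcomp x (Finset.mem_Icc.2 ⟨hx, hx2⟩))]
        omega
      · rfl
    obtain ⟨h1, h2⟩ := ih hL (fun e' he' => hn e' (List.mem_cons_of_mem _ he')) hcut
    refine ⟨⟨⟨ha, ?_, ?_⟩, ?_, ?_⟩, h2⟩
    · simp [symCell, cell]
    · have := hl e.1 ha.1 ha.2
      simp only [symCell, cell]
      omega
    -- A row loses the difference between the new and the old width, or nothing if it was already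
    -- cut further.
    · have hterm : ∀ x ∈ Finset.Icc e.1 m, l x + 1 - (n - linVal j e.2 + 1) =
          (e.2.1 - (W x).1) * j + (e.2.2 - (W x).2) := by
        intro x hx
        rw [← linVal_sub j (hcomp x hx)]
        have hx' := Finset.mem_Icc.1 hx
        rw [hl x (by omega) hx'.2]
        omega
      simp only [aboveSize, symCell, cell]
      rw [Finset.sum_congr rfl hterm, Finset.sum_add_distrib, ← Finset.sum_mul]
      exact Nat.add_le_add (Nat.mul_le_mul_right j hP) hC
    · rwa [show P * j + c - 1 = P * j + (c - 1) by omega]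

theorem binomSum_two_add (x y : ℕ) :
    binomSum 2 (x + y) = binomSum 2 x + x * y + binomSum 2 y := by
  have h1 := two_mul_binomSum (x + y)
  have h2 := two_mul_binomSum x
  have h3 := two_mul_binomSum y
  nlinarith

/-- Adding `P` to `y` changes `T_2(y)` by `y * P + T_2(P)`, a multiple of `d`. -/
theorem binomSum_two_mod {d P : ℕ} (hP : d ∣ P) (hT : d ∣ binomSum 2 P) (j c : ℕ) :
    binomSum 2 (P * j + c) % d = binomSum 2 c % d := by
  induction j with
  | zero => simp
  | succ j ih =>
    rw [show P * (j + 1) + c = (P * j + c) + P by ring, binomSum_two_add, ← ih]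
    obtain ⟨u, hu⟩ := hP
    obtain ⟨v, hv⟩ := hT
    rw [hv]
    generalize binomSum 2 (P * j + c) = z
    generalize P * j + c = y
    rw [hu, show z + y * (d * u) + d * v = z + d * (y * u + v) by ring, Nat.add_mul_mod_self_left]

/-- The numerical conditions on a family under which it yields good passes. -/
def IsGoodFamily (m P c d : ℕ) (L : List (ℕ × ℕ × ℕ)) : Prop :=
  SymFits m P (fun _ => (0, 0)) c L ∧
  (d ∣ m ∧ d ∣ P ∧ d ∣ binomSum 2 P) ∧
  (1 ≤ m ∧ 1 ≤ L.length ∧ L.length ≤ c ∧ (m = 6 → L.length + 9 ≤ c)) ∧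
  ∃ W ∈ [L.foldl symCut (fun _ => (0, 0)) 1],
    (∀ x ∈ Finset.Icc 1 m, L.foldl symCut (fun _ => (0, 0)) x = W) ∧
    (∀ e ∈ L, e.2 ≤ W) ∧
    (2 * (m * W.1) ≤ P * (2 * c - 1) ∧ 2 * (m * W.2) ≤ c * (c - 1) + 2 * m) ∧
    L.length * P ≤ m * W.1 ∧
    2 * (L.length * c) ≤ 2 * (m * W.2) + L.length * (L.length - 1) + 2 * (binomSum 2 c % d)

instance (m P c d : ℕ) (L : List (ℕ × ℕ × ℕ)) : Decidable (IsGoodFamily m P c d L) :=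
  inferInstanceAs (Decidable (_ ∧ _ ∧ _ ∧ _))

/-- With `r` entries and final common width `w`, the area bound `m * (n - w) ≤ T_2(t - r)` follows
from `m * n ≤ T_2(t)` once `m * w ≥ T_2(t) - T_2(t - r)`. The divisor `d` of `m` relaxes this: `m *
n` is a multiple of `d`, so it is at most `T_2(t)` minus the residue of `T_2(t)`, which is that of
`T_2(c)`. -/
theorem IsGoodFamily.isGoodPass {m P c d : ℕ} {L : List (ℕ × ℕ × ℕ)}
    (h : IsGoodFamily m P c d L) {n j : ℕ} (ht : tau 2 (m * n) = P * j + c) :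
    IsGoodPass m n (L.map (symCell n j)) := by
  obtain ⟨hL, ⟨hdm, hdP, hdT⟩, ⟨hm, hL1, hLc, h6⟩, ⟨p, q⟩, -, hW, hmax, ⟨hp, hq⟩, hrp, hrq⟩ := h
  dsimp only at hp hq hrp hrq
  have hle : m * n ≤ binomSum 2 (P * j + c) := (tau_two_le_iff _ _).1 ht.le
  obtain ⟨c', rfl⟩ : ∃ c', c = c' + 1 := ⟨c - 1, by omega⟩
  have hlt : binomSum 2 (P * j + c') < m * n := (lt_tau_two_iff _ _).1 (by omega)
  -- Minimality of `t` gives `T_2(t - 1) < m * n`. Expanding `2 * T_2(t - 1)` in powers of `j`, the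
  -- linear and constant terms already dominate by `hp` and `hq`; the square of `P * j` is
  -- discarded.
  have hwn : linVal j (p, q) ≤ n := by
    by_contra hcon
    have h1 : m * n + m ≤ m * (p * j + q) := by
      have : n + 1 ≤ p * j + q := by
        simp only [linVal] at hcon
        omega
      calc m * n + m = m * (n + 1) := by ring
        _ ≤ _ := Nat.mul_le_mul_left m this
    have h2 := two_mul_binomSum (P * j + c')
    have h3 : 2 * (m * p) * j ≤ P * (2 * c' + 1) * j := Nat.mul_le_mul_right j hp
    have h4 : 2 * (m * q) ≤ (c' + 1) * c' + 2 * m := hq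
    nlinarith [sq_nonneg (P * j)]
  obtain ⟨hf, hfin⟩ := hL.shapeFits (n := n) (j := j) (l := fun _ => n)
    (fun e he => (linVal_mono j (hmax e he)).trans hwn) (fun x _ _ => by simp [linVal])
  have hlen : tau 2 (m * n) - (L.map (symCell n j)).length =
      P * j + (c' + 1 - L.length) := by
    rw [List.length_map]
    omega
  refine ⟨?_, ?_, m, n - linVal j (p, q), ?_, ?_⟩
  · rw [← List.length_pos_iff, List.length_map]
    exact hL1
  · rw [box_eq_shape]
    exact hf.fitsBudget.mono (ht.symm.le.trans (tau_le_boxValue m n))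
  · rw [box_eq_shape, remaining_shape]
    refine shape_eq_box le_rfl fun x hx1 hx2 => ?_
    rw [hfin x hx1 hx2, hW x (Finset.mem_Icc.2 ⟨hx1, hx2⟩), if_pos hx2]
  · have hb := tau_le_boxValue m n
    refine le_trans (boxValue_le ?_ ?_) (hlen.symm.le.trans (by omega))
    · have hmod := binomSum_two_mod hdP hdT j (c' + 1)
      have hle' : m * n + binomSum 2 (c' + 1) % d ≤ binomSum 2 (P * j + (c' + 1)) := by
        rw [← hmod]
        obtain ⟨k, rfl⟩ := hdm
        generalize binomSum 2 (P * j + (c' + 1)) = z at *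
        rcases Nat.eq_zero_or_pos d with rfl | hd
        · omega
        have h1 := Nat.div_add_mod z d
        have h2 : k * n ≤ z / d := by
          rw [Nat.le_div_iff_mul_le hd]
          linarith [hle, mul_assoc d k n, mul_comm (k * n) d]
        have h3 := Nat.mul_le_mul_left d h2
        rw [mul_assoc]
        omega
      obtain ⟨b, hb⟩ := Nat.exists_eq_add_of_le hwn
      have hsub : n - linVal j (p, q) = b := by omega
      rw [hsub]
      obtain ⟨s, hs⟩ := Nat.exists_eq_add_of_le hLc
      rw [hs, Nat.add_sub_cancel_left]
      rw [hs] at hrq hle'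
      generalize L.length = r at *
      obtain ⟨r', rfl⟩ : ∃ r', r = r' + 1 := ⟨r - 1, by omega⟩
      -- With `r = r' + 1`, the drop from `T_2(t)` to `T_2(t - r)` is `(t - r) * r + T_2(r)`. It is
      -- linear in `j`, so `hrp` and `hrq` bound it coefficientwise.
      have e1 : binomSum 2 (P * j + (r' + 1 + s)) =
          binomSum 2 (P * j + s) + (P * j + s) * (r' + 1) + binomSum 2 (r' + 1) := by
        rw [← binomSum_two_add]
        congr 1
        ring
      have e2 := two_mul_binomSum (r' + 1)
      have e3 : (r' + 1) * P * j ≤ m * p * j := Nat.mul_le_mul_right j hrp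
      rw [e1] at hle'
      simp only [linVal] at hb
      subst hb
      generalize binomSum 2 (r' + 1 + s) % d = z at *
      simp only [Nat.add_sub_cancel] at hrq
      nlinarith
    -- A 6 by 6 remainder needs 9, not 8, units of budget.
    · intro h1 _
      have := h6 h1
      omega

end Families

/-! ### Every listed sequence is a good pass -/

section Diagrams

theorem IsGoodFamily.isGoodPass_of_eq {m P c d n j : ℕ} {L : List (ℕ × ℕ × ℕ)}
    {w : List (ℕ × ℕ)} (h : IsGoodFamily m P c d L) (ht : tau 2 (m * n) = P * j + c)
    (hw : w = L.map (symCell n j)) : IsGoodPass m n w :=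
  hw ▸ h.isGoodPass ht

theorem IsGoodPass.ite {m n : ℕ} {p : Prop} [Decidable p] {w w' : List (ℕ × ℕ)}
    (h : p → IsGoodPass m n w) (h' : ¬p → IsGoodPass m n w') :
    IsGoodPass m n (if p then w else w') := by
  by_cases hp : p
  · rw [if_pos hp]
    exact h hp
  · rw [if_neg hp]
    exact h' hp

/-- Here and in the next five lemmas, `P` is the modulus of the residue class and `c` its least
member that is at least the lower bound on `t`. A divisor other than 1 is chosen where the slack
from divisibility is needed. -/
theorem isGoodPass_diagram1 {n t : ℕ} (ht : tau 2 (1 * n) = t) (hl : 7 ≤ t) :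
    IsGoodPass 1 n (diagram1 n t) := by
  unfold diagram1
  obtain ⟨j, rfl⟩ : ∃ j, t = 1 * j + 7 := ⟨(t - 7) / 1, by omega⟩
  refine (show IsGoodFamily 1 1 7 1
      [(1, 1, 7)]
      by decide +kernel).isGoodPass_of_eq ht ?_
  simp [symCell, linVal]

theorem isGoodPass_diagram2 {n t : ℕ} (ht : tau 2 (2 * n) = t) (hl : 10 ≤ t) (hn : 26 ≤ n) :
    IsGoodPass 2 n (diagram2 n t) := by
  unfold diagram2
  refine .ite (fun _ => ?_) (fun _ => ?_)
  · obtain ⟨j, rfl⟩ : ∃ j, t = 2 * j + 10 := ⟨(t - 10) / 2, by omega⟩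
    refine (show IsGoodFamily 2 2 10 1
        [(1, 1, 5)]
      by decide +kernel).isGoodPass_of_eq ht ?_
    simp only [symCell, linVal, cell, List.map_cons, List.map_nil, List.cons.injEq, Prod.mk.injEq,
      true_and, and_true]
    clear * -
    omega
  refine .ite (fun _ => ?_) (fun _ => ?_)
  · omega
  · obtain ⟨j, rfl⟩ : ∃ j, t = 2 * j + 11 := ⟨(t - 11) / 2, by omega⟩
    refine (show IsGoodFamily 2 2 11 1
        [(2, 2, 11), (1, 2, 10), (1, 3, 15)]
      by decide +kernel).isGoodPass_of_eq ht ?_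
    simp only [symCell, linVal, cell, List.map_cons, List.map_nil, List.cons.injEq, Prod.mk.injEq,
      true_and, and_true]
    clear * -
    and_intros <;> omega

theorem isGoodPass_diagram3 {n t : ℕ} (ht : tau 2 (3 * n) = t) (hl : 12 ≤ t) :
    IsGoodPass 3 n (diagram3 n t) := by
  unfold diagram3
  refine .ite (fun _ => ?_) (fun _ => ?_)
  · omega
  refine .ite (fun _ => ?_) (fun _ => ?_)
  · obtain h | h : t % 3 = 0 ∨ t % 3 = 1 := by omega
    · obtain ⟨j, rfl⟩ : ∃ j, t = 3 * j + 12 := ⟨(t - 12) / 3, by omega⟩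
      refine (show IsGoodFamily 3 3 12 1
          [(1, 1, 4)]
      by decide +kernel).isGoodPass_of_eq ht ?_
      simp only [symCell, linVal, cell, List.map_cons, List.map_nil, List.cons.injEq, Prod.mk.injEq,
        true_and, and_true]
      clear * -
      omega
    · obtain ⟨j, rfl⟩ : ∃ j, t = 3 * j + 13 := ⟨(t - 13) / 3, by omega⟩
      refine (show IsGoodFamily 3 3 13 3
          [(1, 1, 4)]
      by decide +kernel).isGoodPass_of_eq ht ?_
      simp only [symCell, linVal, cell, List.map_cons, List.map_nil, List.cons.injEq, Prod.mk.injEq,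
        true_and, and_true]
      clear * -
      omega
  refine .ite (fun _ => ?_) (fun _ => ?_)
  · obtain ⟨j, rfl⟩ : ∃ j, t = 6 * j + 14 := ⟨(t - 14) / 6, by omega⟩
    refine (show IsGoodFamily 3 6 14 1
        [(2, 3, 7), (1, 4, 9)]
      by decide +kernel).isGoodPass_of_eq ht ?_
    simp only [symCell, linVal, cell, List.map_cons, List.map_nil, List.cons.injEq, Prod.mk.injEq,
      true_and, and_true]
    clear * -
    and_intros <;> omega
  refine .ite (fun _ => ?_) (fun _ => ?_)
  · obtain ⟨j, rfl⟩ : ∃ j, t = 6 * j + 17 := ⟨(t - 17) / 6, by omega⟩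
    refine (show IsGoodFamily 3 6 17 1
        [(3, 6, 17), (2, 6, 16), (2, 9, 24), (1, 6, 14), (1, 10, 25)]
      by decide +kernel).isGoodPass_of_eq ht ?_
    simp only [symCell, linVal, cell, List.map_cons, List.map_nil, List.cons.injEq, Prod.mk.injEq,
      true_and, and_true]
    clear * -
    and_intros <;> omega
  · omega

theorem isGoodPass_diagram4 {n t : ℕ} (ht : tau 2 (4 * n) = t) (hl : 14 ≤ t) :
    IsGoodPass 4 n (diagram4 n t) := by
  unfold diagram4
  refine .ite (fun _ => ?_) (fun _ => ?_)
  · omega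
  refine .ite (fun _ => ?_) (fun _ => ?_)
  · omega
  refine .ite (fun _ => ?_) (fun _ => ?_)
  · obtain h | h : t % 4 = 0 ∨ t % 4 = 1 := by omega
    · obtain ⟨j, rfl⟩ : ∃ j, t = 4 * j + 16 := ⟨(t - 16) / 4, by omega⟩
      refine (show IsGoodFamily 4 4 16 1
          [(1, 1, 4)]
      by decide +kernel).isGoodPass_of_eq ht ?_
      simp only [symCell, linVal, cell, List.map_cons, List.map_nil, List.cons.injEq, Prod.mk.injEq,
        true_and, and_true]
      clear * -
      omega
    · obtain ⟨j, rfl⟩ : ∃ j, t = 4 * j + 17 := ⟨(t - 17) / 4, by omega⟩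
      refine (show IsGoodFamily 4 4 17 2
          [(1, 1, 4)]
      by decide +kernel).isGoodPass_of_eq ht ?_
      simp only [symCell, linVal, cell, List.map_cons, List.map_nil, List.cons.injEq, Prod.mk.injEq,
        true_and, and_true]
      clear * -
      omega
  refine .ite (fun _ => ?_) (fun _ => ?_)
  · obtain ⟨j, rfl⟩ : ∃ j, t = 4 * j + 14 := ⟨(t - 14) / 4, by omega⟩
    refine (show IsGoodFamily 4 4 14 1
        [(4, 4, 14), (3, 4, 13), (2, 4, 12), (1, 4, 11), (1, 5, 15)]
      by decide +kernel).isGoodPass_of_eq ht ?_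
    simp only [symCell, linVal, cell, List.map_cons, List.map_nil, List.cons.injEq, Prod.mk.injEq,
      true_and, and_true]
    clear * -
    and_intros <;> omega
  refine .ite (fun _ => ?_) (fun _ => ?_)
  · obtain ⟨j, rfl⟩ : ∃ j, t = 12 * j + 15 := ⟨(t - 15) / 12, by omega⟩
    refine (show IsGoodFamily 4 12 15 1
        [(4, 12, 15), (3, 12, 14), (2, 12, 13), (2, 16, 18), (1, 12, 11), (3, 22, 23),
        (1, 20, 19), (1, 24, 23)]
      by decide +kernel).isGoodPass_of_eq ht ?_
    simp only [symCell, linVal, cell, List.map_cons, List.map_nil, List.cons.injEq, Prod.mk.injEq,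
      true_and, and_true]
    clear * -
    and_intros <;> omega
  refine .ite (fun _ => ?_) (fun _ => ?_)
  · obtain ⟨j, rfl⟩ : ∃ j, t = 12 * j + 19 := ⟨(t - 19) / 12, by omega⟩
    refine (show IsGoodFamily 4 12 19 1
        [(4, 12, 19), (3, 12, 18), (2, 12, 17), (1, 12, 16), (2, 16, 23), (3, 22, 30),
        (1, 20, 26), (1, 24, 31)]
      by decide +kernel).isGoodPass_of_eq ht ?_
    simp only [symCell, linVal, cell, List.map_cons, List.map_nil, List.cons.injEq, Prod.mk.injEq,
      true_and, and_true]
    clear * -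
    and_intros <;> omega
  refine .ite (fun _ => ?_) (fun _ => ?_)
  · obtain ⟨j, rfl⟩ : ∃ j, t = 12 * j + 23 := ⟨(t - 23) / 12, by omega⟩
    refine (show IsGoodFamily 4 12 23 1
        [(4, 12, 23), (3, 12, 22), (3, 18, 33), (2, 12, 20), (2, 20, 35), (1, 12, 18),
        (1, 21, 35)]
      by decide +kernel).isGoodPass_of_eq ht ?_
    simp only [symCell, linVal, cell, List.map_cons, List.map_nil, List.cons.injEq, Prod.mk.injEq,
      true_and, and_true]
    clear * -
    and_intros <;> omega
  · omega

theorem isGoodPass_diagram5 {n t : ℕ} (ht : tau 2 (5 * n) = t) (hl : 16 ≤ t) :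
    IsGoodPass 5 n (diagram5 n t) := by
  unfold diagram5
  refine .ite (fun _ => ?_) (fun _ => ?_)
  · omega
  refine .ite (fun _ => ?_) (fun _ => ?_)
  · omega
  refine .ite (fun _ => ?_) (fun _ => ?_)
  · obtain h | h | h : t % 5 = 0 ∨ t % 5 = 1 ∨ t % 5 = 2 := by omega
    · obtain ⟨j, rfl⟩ : ∃ j, t = 5 * j + 20 := ⟨(t - 20) / 5, by omega⟩
      refine (show IsGoodFamily 5 5 20 1
          [(1, 1, 4)]
      by decide +kernel).isGoodPass_of_eq ht ?_
      simp only [symCell, linVal, cell, List.map_cons, List.map_nil, List.cons.injEq, Prod.mk.injEq,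
        true_and, and_true]
      clear * -
      omega
    · obtain ⟨j, rfl⟩ : ∃ j, t = 5 * j + 16 := ⟨(t - 16) / 5, by omega⟩
      refine (show IsGoodFamily 5 5 16 5
          [(1, 1, 3)]
      by decide +kernel).isGoodPass_of_eq ht ?_
      simp only [symCell, linVal, cell, List.map_cons, List.map_nil, List.cons.injEq, Prod.mk.injEq,
        true_and, and_true]
      clear * -
      omega
    · obtain ⟨j, rfl⟩ : ∃ j, t = 5 * j + 17 := ⟨(t - 17) / 5, by omega⟩
      refine (show IsGoodFamily 5 5 17 5
          [(1, 1, 3)]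
      by decide +kernel).isGoodPass_of_eq ht ?_
      simp only [symCell, linVal, cell, List.map_cons, List.map_nil, List.cons.injEq, Prod.mk.injEq,
        true_and, and_true]
      clear * -
      omega
  refine .ite (fun _ => ?_) (fun _ => ?_)
  · obtain ⟨j, rfl⟩ : ∃ j, t = 10 * j + 23 := ⟨(t - 23) / 10, by omega⟩
    refine (show IsGoodFamily 5 10 23 5
        [(4, 5, 11), (2, 5, 11), (1, 6, 13)]
      by decide +kernel).isGoodPass_of_eq ht ?_
    simp only [symCell, linVal, cell, List.map_cons, List.map_nil, List.cons.injEq, Prod.mk.injEq,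
      true_and, and_true]
    clear * -
    and_intros <;> omega
  refine .ite (fun _ => ?_) (fun _ => ?_)
  · obtain ⟨j, rfl⟩ : ∃ j, t = 10 * j + 18 := ⟨(t - 18) / 10, by omega⟩
    refine (show IsGoodFamily 5 10 18 5
        [(4, 5, 9), (2, 5, 8), (1, 6, 10)]
      by decide +kernel).isGoodPass_of_eq ht ?_
    simp only [symCell, linVal, cell, List.map_cons, List.map_nil, List.cons.injEq, Prod.mk.injEq,
      true_and, and_true]
    clear * -
    and_intros <;> omega
  refine .ite (fun _ => ?_) (fun _ => ?_)
  · obtain ⟨j, rfl⟩ : ∃ j, t = 30 * j + 34 := ⟨(t - 34) / 30, by omega⟩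
    refine (show IsGoodFamily 5 30 34 1
        [(5, 30, 34), (4, 30, 33), (3, 30, 32), (2, 30, 31), (1, 30, 30), (4, 45, 48),
        (3, 50, 52), (1, 45, 44), (1, 54, 54)]
      by decide +kernel).isGoodPass_of_eq ht ?_
    simp only [symCell, linVal, cell, List.map_cons, List.map_nil, List.cons.injEq, Prod.mk.injEq,
      true_and, and_true]
    clear * -
    and_intros <;> omega
  refine .ite (fun _ => ?_) (fun _ => ?_)
  · obtain ⟨j, rfl⟩ : ∃ j, t = 30 * j + 39 := ⟨(t - 39) / 30, by omega⟩
    refine (show IsGoodFamily 5 30 39 1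
        [(5, 30, 39), (4, 30, 38), (3, 30, 37), (1, 15, 18), (4, 45, 56), (3, 50, 61),
        (2, 45, 51), (1, 45, 50), (1, 54, 63)]
      by decide +kernel).isGoodPass_of_eq ht ?_
    simp only [symCell, linVal, cell, List.map_cons, List.map_nil, List.cons.injEq, Prod.mk.injEq,
      true_and, and_true]
    clear * -
    and_intros <;> omega
  refine .ite (fun _ => ?_) (fun _ => ?_)
  · obtain ⟨j, rfl⟩ : ∃ j, t = 30 * j + 44 := ⟨(t - 44) / 30, by omega⟩
    refine (show IsGoodFamily 5 30 44 1
        [(5, 30, 44), (4, 30, 43), (3, 30, 42), (4, 45, 64), (3, 50, 70), (2, 30, 39),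
        (1, 30, 38), (1, 45, 57), (1, 54, 72)]
      by decide +kernel).isGoodPass_of_eq ht ?_
    simp only [symCell, linVal, cell, List.map_cons, List.map_nil, List.cons.injEq, Prod.mk.injEq,
      true_and, and_true]
    clear * -
    and_intros <;> omega
  refine .ite (fun _ => ?_) (fun _ => ?_)
  · obtain ⟨j, rfl⟩ : ∃ j, t = 30 * j + 19 := ⟨(t - 19) / 30, by omega⟩
    refine (show IsGoodFamily 5 30 19 1
        [(5, 30, 19), (4, 30, 18), (3, 30, 17), (2, 30, 16), (4, 45, 26), (1, 30, 14),
        (1, 40, 20), (2, 50, 26), (1, 54, 27)]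
      by decide +kernel).isGoodPass_of_eq ht ?_
    simp only [symCell, linVal, cell, List.map_cons, List.map_nil, List.cons.injEq, Prod.mk.injEq,
      true_and, and_true]
    clear * -
    and_intros <;> omega
  refine .ite (fun _ => ?_) (fun _ => ?_)
  · obtain ⟨j, rfl⟩ : ∃ j, t = 30 * j + 24 := ⟨(t - 24) / 30, by omega⟩
    refine (show IsGoodFamily 5 30 24 1
        [(5, 30, 24), (4, 30, 23), (3, 30, 22), (3, 40, 30), (2, 30, 20), (1, 30, 19),
        (3, 50, 36), (1, 45, 28), (1, 54, 36)]
      by decide +kernel).isGoodPass_of_eq ht ?_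
    simp only [symCell, linVal, cell, List.map_cons, List.map_nil, List.cons.injEq, Prod.mk.injEq,
      true_and, and_true]
    clear * -
    and_intros <;> omega
  refine .ite (fun _ => ?_) (fun _ => ?_)
  · obtain ⟨j, rfl⟩ : ∃ j, t = 30 * j + 29 := ⟨(t - 29) / 30, by omega⟩
    refine (show IsGoodFamily 5 30 29 1
        [(5, 30, 29), (4, 30, 28), (3, 30, 27), (2, 30, 26), (4, 45, 41), (1, 30, 24),
        (3, 50, 44), (1, 45, 36), (1, 54, 45)]
      by decide +kernel).isGoodPass_of_eq ht ?_
    simp only [symCell, linVal, cell, List.map_cons, List.map_nil, List.cons.injEq, Prod.mk.injEq,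
      true_and, and_true]
    clear * -
    and_intros <;> omega
  · omega

/-- The bound on `n` rules out the lists reserved for particular `n`, so only residues of `t`
matter. -/
theorem isGoodPass_diagram6 {n t : ℕ} (ht : tau 2 (6 * n) = t) (hl : 18 ≤ t) (hn : 26 ≤ n) :
    IsGoodPass 6 n (diagram6 n t) := by
  unfold diagram6
  simp only [List.mem_cons, List.not_mem_nil, or_false]
  refine .ite (fun _ => ?_) (fun _ => ?_)
  · omega
  refine .ite (fun _ => ?_) (fun _ => ?_)
  · omega
  refine .ite (fun _ => ?_) (fun _ => ?_)
  · obtain h | h : t % 6 = 0 ∨ t % 6 = 1 := by omega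
    · obtain ⟨j, rfl⟩ : ∃ j, t = 6 * j + 18 := ⟨(t - 18) / 6, by omega⟩
      refine (show IsGoodFamily 6 6 18 1
          [(1, 1, 3)]
      by decide +kernel).isGoodPass_of_eq ht ?_
      simp only [symCell, linVal, cell, List.map_cons, List.map_nil, List.cons.injEq, Prod.mk.injEq,
        true_and, and_true]
      clear * -
      omega
    · obtain ⟨j, rfl⟩ : ∃ j, t = 6 * j + 19 := ⟨(t - 19) / 6, by omega⟩
      refine (show IsGoodFamily 6 6 19 3
          [(1, 1, 3)]
      by decide +kernel).isGoodPass_of_eq ht ?_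
      simp only [symCell, linVal, cell, List.map_cons, List.map_nil, List.cons.injEq, Prod.mk.injEq,
        true_and, and_true]
      clear * -
      omega
  refine .ite (fun _ => ?_) (fun _ => ?_)
  · obtain ⟨j, rfl⟩ : ∃ j, t = 6 * j + 22 := ⟨(t - 22) / 6, by omega⟩
    refine (show IsGoodFamily 6 6 22 3
        [(4, 2, 7), (1, 2, 7)]
      by decide +kernel).isGoodPass_of_eq ht ?_
    simp only [symCell, linVal, cell, List.map_cons, List.map_nil, List.cons.injEq, Prod.mk.injEq,
      true_and, and_true]
    clear * -
    and_intros <;> omega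
  refine .ite (fun _ => ?_) (fun _ => ?_)
  · omega
  refine .ite (fun _ => ?_) (fun _ => ?_)
  · obtain ⟨j, rfl⟩ : ∃ j, t = 6 * j + 21 := ⟨(t - 21) / 6, by omega⟩
    refine (show IsGoodFamily 6 6 21 1
        [(4, 2, 7), (5, 5, 17), (4, 6, 20), (3, 6, 18), (2, 6, 17), (1, 6, 16), (1, 7, 21)]
      by decide +kernel).isGoodPass_of_eq ht ?_
    simp only [symCell, linVal, cell, List.map_cons, List.map_nil, List.cons.injEq, Prod.mk.injEq,
      true_and, and_true]
    clear * -
    and_intros <;> omega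
  refine .ite (fun _ => ?_) (fun _ => ?_)
  · obtain ⟨j, rfl⟩ : ∃ j, t = 12 * j + 26 := ⟨(t - 26) / 12, by omega⟩
    refine (show IsGoodFamily 6 12 26 1
        [(6, 12, 26), (5, 12, 25), (4, 12, 24), (3, 12, 23), (3, 15, 30), (2, 12, 21),
        (1, 12, 20), (1, 16, 30)]
      by decide +kernel).isGoodPass_of_eq ht ?_
    simp only [symCell, linVal, cell, List.map_cons, List.map_nil, List.cons.injEq, Prod.mk.injEq,
      true_and, and_true]
    clear * -
    and_intros <;> omega
  refine .ite (fun _ => ?_) (fun _ => ?_)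
  · obtain ⟨j, rfl⟩ : ∃ j, t = 12 * j + 29 := ⟨(t - 29) / 12, by omega⟩
    refine (show IsGoodFamily 6 12 29 1
        [(6, 12, 29), (5, 12, 28), (4, 12, 27), (2, 6, 13), (1, 8, 17), (1, 12, 25),
        (3, 15, 33), (1, 16, 34)]
      by decide +kernel).isGoodPass_of_eq ht ?_
    simp only [symCell, linVal, cell, List.map_cons, List.map_nil, List.cons.injEq, Prod.mk.injEq,
      true_and, and_true]
    clear * -
    and_intros <;> omega
  refine .ite (fun _ => ?_) (fun _ => ?_)
  · obtain ⟨j, rfl⟩ : ∃ j, t = 12 * j + 20 := ⟨(t - 20) / 12, by omega⟩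
    refine (show IsGoodFamily 6 12 20 1
        [(6, 12, 20), (5, 12, 19), (4, 12, 18), (3, 12, 17), (2, 12, 16), (1, 12, 15),
        (3, 15, 22), (1, 16, 22)]
      by decide +kernel).isGoodPass_of_eq ht ?_
    simp only [symCell, linVal, cell, List.map_cons, List.map_nil, List.cons.injEq, Prod.mk.injEq,
      true_and, and_true]
    clear * -
    and_intros <;> omega
  refine .ite (fun _ => ?_) (fun _ => ?_)
  · obtain ⟨j, rfl⟩ : ∃ j, t = 12 * j + 23 := ⟨(t - 23) / 12, by omega⟩
    refine (show IsGoodFamily 6 12 23 1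
        [(6, 12, 23), (5, 12, 22), (4, 12, 21), (3, 12, 20), (2, 12, 19), (3, 15, 26),
        (1, 12, 17), (1, 16, 26)]
      by decide +kernel).isGoodPass_of_eq ht ?_
    simp only [symCell, linVal, cell, List.map_cons, List.map_nil, List.cons.injEq, Prod.mk.injEq,
      true_and, and_true]
    clear * -
    and_intros <;> omega
  · omega

/-- A decidable form of `IsGoodPass m n w`, where `t = tau 2 (m * n)`. -/
def IsGoodPassShape (m n t : ℕ) (w : List (ℕ × ℕ)) : Prop :=
  ∃ v ∈ [if m = 6 ∧ n = 6 then 9 else t], w ≠ [] ∧ ShapeFits m (fun _ => n) v w ∧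
    ∃ a ∈ Finset.Icc 0 m, ∃ b ∈ [w.foldl cut (fun _ => n) 1],
      (∀ x ∈ Finset.Icc 1 m, w.foldl cut (fun _ => n) x = if x ≤ a then b else 0) ∧
      a * b ≤ binomSum 2 (v - w.length) ∧ (a = 6 → b = 6 → 9 ≤ v - w.length)

instance (m n t : ℕ) (w : List (ℕ × ℕ)) : Decidable (IsGoodPassShape m n t w) :=
  inferInstanceAs (Decidable (∃ v ∈ [if m = 6 ∧ n = 6 then 9 else t], w ≠ [] ∧ _ ∧ _))

theorem IsGoodPassShape.isGoodPass {m n t : ℕ} {w : List (ℕ × ℕ)}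
    (h : IsGoodPassShape m n t w) (ht : tau 2 (m * n) = t) : IsGoodPass m n w := by
  obtain ⟨v, hv, hw, hf, a, ha, b, -, hx, hab, h6⟩ := h
  have hv' : boxValue m n = v := by
    rw [List.mem_singleton.1 hv, boxValue, ht]
  refine ⟨hw, ?_, a, b, ?_, ?_⟩
  · rw [box_eq_shape, hv']
    exact hf.fitsBudget
  · rw [box_eq_shape, remaining_shape]
    exact shape_eq_box (Finset.mem_Icc.1 ha).2 fun x h1 h2 => hx x (Finset.mem_Icc.2 ⟨h1, h2⟩)
  · rw [hv']
    exact boxValue_le hab h6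

-- The two inequalities characterise `t` as `tau 2 (m * n)` without the infimum, which keeps the
-- statement decidable by evaluation.
set_option maxRecDepth 10000 in
theorem isGoodPassShape_diagram : ∀ m ∈ Finset.Icc 1 6, ∀ n ∈ Finset.Icc m 25,
    ∀ t ∈ Finset.Icc 1 17, binomSum 2 (t - 1) < m * n → m * n ≤ binomSum 2 t →
      IsGoodPassShape m n t (diagram m n t) := by
  decide +kernel

theorem isGoodPass_diagram {m n : ℕ} (hm : 1 ≤ m) (hm6 : m ≤ 6) (hmn : m ≤ n) :
    IsGoodPass m n (diagram m n (tau 2 (m * n))) := by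
  rcases Nat.lt_or_ge 25 n with hn | hn
  -- The lower bounds on `t` required of the families are the values of `tau 2` at `m * 26`.
  · have hlow : ∀ s, binomSum 2 s < m * 26 → s < tau 2 (m * n) := fun s hs =>
      (lt_tau_two_iff _ _).2 (hs.trans_le (Nat.mul_le_mul_left m hn))
    obtain rfl | rfl | rfl | rfl | rfl | rfl :
      m = 1 ∨ m = 2 ∨ m = 3 ∨ m = 4 ∨ m = 5 ∨ m = 6 := by omega
    · exact isGoodPass_diagram1 rfl (hlow 6 (by decide))
    · exact isGoodPass_diagram2 rfl (hlow 9 (by decide)) hn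
    · exact isGoodPass_diagram3 rfl (hlow 11 (by decide))
    · exact isGoodPass_diagram4 rfl (hlow 13 (by decide))
    · exact isGoodPass_diagram5 rfl (hlow 15 (by decide))
    · exact isGoodPass_diagram6 rfl (hlow 17 (by decide)) hn
  · have hpos : 0 < tau 2 (m * n) :=
      (lt_tau_two_iff _ _).2 (by rw [binomSum_two_zero]; exact Nat.mul_pos hm (hm.trans hmn))
    -- The area is at most 6 * 25 = 150, and `T_2(17)` = 153.
    have h17 : tau 2 (m * n) ≤ 17 :=
      (tau_two_le_iff _ _).2 ((Nat.mul_le_mul hm6 hn).trans (by decide))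
    exact (isGoodPassShape_diagram m (Finset.mem_Icc.2 ⟨hm, hm6⟩) n (Finset.mem_Icc.2 ⟨hmn, hn⟩)
      _ (Finset.mem_Icc.2 ⟨hpos, h17⟩) ((lt_tau_two_iff _ _).1 (by omega))
      ((tau_two_le_iff _ _).1 le_rfl)).isGoodPass rfl

end Diagrams

/-! ### Running the algorithm, and transfer to arbitrary finite chains -/

section Algorithm

theorem isGoodPass_passSeq {m n : ℕ} (hm : 1 ≤ m) (hn : 1 ≤ n) (h6 : m ≤ 6 ∨ n ≤ 6) :
    IsGoodPass m n (passSeq m n) := by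
  unfold passSeq
  split_ifs with h
  · rw [mul_comm m n]
    exact (isGoodPass_diagram hn (by omega) h.le).swap
  · exact isGoodPass_diagram hm (by omega) (by omega)

theorem box_injective {a b a' b' : ℕ} (hne : box a b ≠ ∅) (h : box a b = box a' b') :
    a = a' ∧ b = b' := by
  obtain ⟨⟨x, y⟩, hp⟩ := Finset.nonempty_iff_ne_empty.2 hne
  have hp' := mem_box.1 hp
  have key : ∀ q : ℕ × ℕ, q ∈ box a b ↔ q ∈ box a' b' := fun q => by rw [h]
  simp only [mem_box] at key hp'
  have h1 := (key (a, y)).1 (by omega)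
  have h2 := (key (x, b)).1 (by omega)
  have h3 := (key (a', y)).2 (by omega)
  have h4 := (key (x, b')).2 (by omega)
  omega

/-- The only freedom in a run is the description of the remainder as a box, and a nonempty box
determines its sides. -/
theorem AlgReturns.unique {m n : ℕ} {w w' : List (ℕ × ℕ)} (h : AlgReturns m n w)
    (h' : AlgReturns m n w') : w = w' := by
  induction h generalizing w' with
  | finish m n h =>
    cases h' with
    | finish => rfl
    | again _ _ a b w hne => exact absurd h hne
  | again m n a b w hne hab _ ih =>
    cases h' with
    | finish _ _ h => exact absurd h hne
    | again _ _ a' b' w' _ hab' hw' =>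
      obtain ⟨rfl, rfl⟩ := box_injective (hab ▸ hne) (hab.symm.trans hab')
      rw [ih hw']

/-- Induction on the area: a good pass is nonempty, so it removes something, and the strategy for
the remainder fits into the budget that is left. -/
theorem exists_algReturns {m n : ℕ} (hm : 1 ≤ m) (hn : 1 ≤ n) (h6 : m ≤ 6 ∨ n ≤ 6) :
    ∃ w, AlgReturns m n w ∧ FitsBudget (box m n) (boxValue m n) w ∧
      remaining (box m n) w = ∅ := by
  induction hk : m * n using Nat.strong_induction_on generalizing m n with
  | _ k ih =>
    have hpass := isGoodPass_passSeq hm hn h6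
    obtain ⟨a, b, hr, hv⟩ := hpass.remaining_eq
    by_cases hne : remaining (box m n) (passSeq m n) = ∅
    · exact ⟨_, .finish m n hne, hpass.fitsBudget, hne⟩
    · obtain ⟨p, hp⟩ := Finset.nonempty_iff_ne_empty.2 (hr ▸ hne)
      have hp' := mem_box.1 hp
      -- The top corner of the remainder lies in the original box, so neither side has grown and one
      -- of them is still at most 6.
      have hab : (a, b) ∈ box m n :=
        remaining_subset _ (passSeq m n) (hr ▸ mem_box.2 (by dsimp only; omega))
      have hab' := mem_box.1 hab
      dsimp only at hab'
      have hlt : a * b < k := by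
        obtain ⟨c, w, hw⟩ := List.exists_cons_of_ne_nil hpass.ne_nil
        have hc : c ∈ box m n := hpass.fitsBudget.spec.1 c (by simp [hw])
        have := card_remaining_lt hc w
        rwa [← hw, hr, card_box, card_box, hk] at this
      obtain ⟨w, hw, hf, hrem⟩ := ih (a * b) hlt hab'.1.1 hab'.2.1 (by omega) rfl
      refine ⟨_, .again m n a b w hne hr hw, hpass.fitsBudget.append ?_, ?_⟩
      · rw [hr]
        exact hf.mono hv
      · rw [remaining_append, hr, hrem]

theorem boxValue_le_quicksand (m n : ℕ) : boxValue m n ≤ quicksand 2 (box m n) := by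
  unfold boxValue
  split_ifs with h
  · obtain ⟨rfl, rfl⟩ := h
    exact eight_lt_quicksand_box_six
  · have := tau_two_card_le_quicksand (box m n)
    rwa [card_box] at this

theorem quicksand_box {m n : ℕ} (h6 : m ≤ 6 ∨ n ≤ 6) : quicksand 2 (box m n) = boxValue m n := by
  refine le_antisymm ?_ (boxValue_le_quicksand m n)
  by_cases h : 1 ≤ m ∧ 1 ≤ n
  · obtain ⟨w, -, hf, hr⟩ := exists_algReturns h.1 h.2 h6
    exact hf.quicksand_le hr
  -- A chain in part (a) may be empty, a case outside the range of the algorithm.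
  · have : box m n = ∅ := by
      rw [← Finset.card_eq_zero, card_box, Nat.mul_eq_zero]
      omega
    simp [this, quicksand_empty]

/-- The order embedding of a finite linear order into `ℕ` with image `{1, …, card}`. -/
noncomputable def natEmbedding (κ : Type u) [LinearOrder κ] [Fintype κ] : κ ↪o ℕ :=
  OrderEmbedding.ofMapLEIff
    (fun x => ((Fintype.orderIsoFinOfCardEq κ rfl).symm x : ℕ) + 1) (by simp)

theorem mem_range_natEmbedding (κ : Type u) [LinearOrder κ] [Fintype κ] (i : ℕ) :
    (∃ x, natEmbedding κ x = i) ↔ 1 ≤ i ∧ i ≤ Fintype.card κ := by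
  constructor
  · rintro ⟨x, rfl⟩
    have := ((Fintype.orderIsoFinOfCardEq κ rfl).symm x).isLt
    simp only [natEmbedding, OrderEmbedding.coe_ofMapLEIff]
    omega
  · rintro ⟨h1, h2⟩
    refine ⟨Fintype.orderIsoFinOfCardEq κ rfl ⟨i - 1, by omega⟩, ?_⟩
    simp only [natEmbedding, OrderEmbedding.coe_ofMapLEIff, OrderIso.symm_apply_apply]
    omega

theorem quicksand_univ_prod (κ : Type u) (ν : Type v) [LinearOrder κ] [Fintype κ]
    [LinearOrder ν] [Fintype ν] :
    quicksand 2 (Finset.univ : Finset (κ × ν)) =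
      quicksand 2 (box (Fintype.card κ) (Fintype.card ν)) := by
  let f : κ × ν ↪o ℕ × ℕ := OrderEmbedding.ofMapLEIff
    (fun p => (natEmbedding κ p.1, natEmbedding ν p.2)) (by simp [Prod.le_def])
  rw [← quicksand_two_map f]
  congr 1
  ext ⟨x, y⟩
  simp only [mem_box, ← mem_range_natEmbedding, Finset.mem_map, Finset.mem_univ, true_and]
  constructor
  · rintro ⟨⟨a, b⟩, h⟩
    exact ⟨⟨a, congrArg Prod.fst h⟩, b, congrArg Prod.snd h⟩
  · rintro ⟨⟨a, rfl⟩, b, rfl⟩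
    exact ⟨(a, b), rfl⟩

end Algorithm

theorem theoremB :
    (∀ (κ : Type u) (ν : Type v) [LinearOrder κ] [Fintype κ] [LinearOrder ν] [Fintype ν],
      Fintype.card κ ≤ 6 ∨ Fintype.card ν ≤ 6 →
      quicksand 2 (Finset.univ : Finset (κ × ν)) =
        if Fintype.card κ = 6 ∧ Fintype.card ν = 6 then 9
        else tau 2 (Fintype.card κ * Fintype.card ν)) ∧
    (∀ m n : ℕ, 1 ≤ m → 1 ≤ n → m ≤ 6 ∨ n ≤ 6 →
      quicksand 2 (box m n) = (if m = 6 ∧ n = 6 then 9 else tau 2 (m * n)) ∧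
      ∃ w : List (ℕ × ℕ), (∀ w' : List (ℕ × ℕ), AlgReturns m n w' ↔ w' = w) ∧
        IsStrategy (box m n) w ∧ stratCost (box m n) w = quicksand 2 (box m n)) := by
  refine ⟨fun κ ν _ _ _ _ h6 => ?_, fun m n hm hn h6 => ⟨quicksand_box h6, ?_⟩⟩
  · rw [quicksand_univ_prod, quicksand_box h6, boxValue]
  · obtain ⟨w, hw, hf, hr⟩ := exists_algReturns hm hn h6
    refine ⟨w, fun w' => ⟨fun h => h.unique hw, fun h => h ▸ hw⟩, hf.isStrategy hr, ?_⟩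
    -- No strategy costs less than `q_2`, and the budget within which `w` was played equals `q_2`.
    refine le_antisymm ?_ (hf.isStrategy hr).quicksand_le_stratCost
    rw [quicksand_box h6]
    exact hf.stratCost_le
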